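/- Let $M$ be a smooth manifold and let $(\mathcal A,\rho,[\cdot,\cdot])$ be a Lie algebroid over $M$: a smooth real vector bundle of finite rank with a Lie bracket on $\Gamma(\mathcal A)$ and a smooth bundle map $\rho:\mathcal A\to TM$ (the anchor) such that $\rho([S_1,S_2])=[\rho(S_1),\rho(S_2)]$ and $[S_1,fS_2]=f[S_1,S_2]+(\rho(S_1)\cdot f)S_2$ for all sections $S_1,S_2$ and all $f\in C^\infty(M)$. A *compatible triple* $(\omega,J,g)$ on $\mathcal A$ consists of a smooth nondegenerate 2-form $\omega$ on $\mathcal A$ that is closed for the Lie algebroid differential $d^{\mathcal A}$, a smooth bundle endomorphism $J$ of $\mathcal A$ with $J^2=-\mathrm{id}$, and a smooth Riemannian metric $g$ on $\mathcal A$, such that $g(JS,JT)=g(S,T)$ and $\omega(S,T)=g(S,JT)$. A compatible triple on a manifold $O$ is a compatible triple on the Lie algebroid $TO$ (identity anchor, Lie bracket of vector fields). Let $(\omega,J,g)$ be a compatible triple on $\mathcal A$. For $p\in M$ let $L_p=\ker\rho_p$, let $W^\omega$ denote the $\omega$-orthogonal complement of a subspace $W\subseteq\mathcal A_p$, and put $$L^1_p=L_p\cap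 L_p^\omega,\qquad L^2_p=\{v\in L_p : g(v,w)=0\ \text{for all } w\in L^1_p\},\qquad E^1_p=J(L^1_p),\qquad E^2_p=(L_p+E^1_p)^\omega .$$ Let $\Lambda_p=\rho(E^2_p+L^1_p)\subseteq T_pM$. **Theorem.** Suppose that $J(L^2_p)\subseteq L^2_p$ for every $p\in M$. Then $J(E^2_p)\subseteq E^2_p$ for every $p\in M$. Moreover, let $\mathcal O$ be an integral submanifold of $\Lambda$, that is, an (injectively) immersed submanifold of $M$ with $T_p\mathcal O=\Lambda_p$ for every $p\in\mathcal O$. Then there is exactly one compatible triple $(\omega_{\mathcal O},J_{\mathcal O},g_{\mathcal O})$ on $\mathcal O$ such that, for all $p\in\mathcal O$ and $X,Y\in T_p\mathcal O$, $$\omega_{\mathcal O}(X,Y)=\omega(a,b)\quad\text{for all } a,b\in E^2_p+L^1_p \text{ with } \rho(a)=X,\ \rho(b)=Y,$$ $$J_{\mathcal O}(X)=\rho(J(a)),\quad g_{\mathcal O}(X,Y)=g(a,b)\quad\text{for all } a,b\in E^2_p \text{ with } \rho(a)=X,\ \rho(b)=Y.$$ In other words, the forms $\omega_{\mathcal O}$,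 $J_{\mathcal O}$, $g_{\mathcal O}$ induced by $(\omega,J,g)$ are well defined and smooth, and form a compatible triple on $\mathcal O$. -/

import Mathlib

open Bundle Manifold
open scoped ContDiff

noncomputable section

namespace CompatTriples

section General

variable {E : Type*} [NormedAddCommGroup E] [NormedSpace ℝ E]
  {H : Type*} [TopologicalSpace H] (I : ModelWithCorners ℝ E H)
  {M : Type*} [TopologicalSpace M] [ChartedSpace H M] [IsManifold I ∞ M]
  (F : Type*) [NormedAddCommGroup F] [NormedSpace ℝ F]
  (A : M → Type*) [TopologicalSpace (TotalSpace F A)]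
  [∀ x, TopologicalSpace (A x)] [∀ x, AddCommGroup (A x)] [∀ x, Module ℝ (A x)]
  [∀ x, IsTopologicalAddGroup (A x)] [∀ x, ContinuousSMul ℝ (A x)]
  [FiberBundle F A] [VectorBundle ℝ F A]

/-- The directional derivative `v · f` of a real function along a tangent vector. -/
def dirDeriv {M : Type*} [TopologicalSpace M] [ChartedSpace H M]
    (f : M → ℝ) (x : M) (v : TangentSpace I x) : ℝ :=
  mfderiv I 𝓘(ℝ, ℝ) f x v

/-- The product of a smooth function and a smooth section. -/
def smulSection {I : ModelWithCorners ℝ E H} {F : Type*} [NormedAddCommGroup F] [NormedSpace ℝ F]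
    {M : Type*} [TopologicalSpace M] [ChartedSpace H M]
    {A : M → Type*} [TopologicalSpace (TotalSpace F A)]
    [∀ x, TopologicalSpace (A x)] [∀ x, AddCommGroup (A x)] [∀ x, Module ℝ (A x)]
    [FiberBundle F A] [VectorBundle ℝ F A]
    (f : C^∞⟮I, M; 𝓘(ℝ, ℝ), ℝ⟯) (s : Cₛ^∞⟮I; F, A⟯) : Cₛ^∞⟮I; F, A⟯ :=
  ⟨fun x => f x • s x, f.contMDiff.smul_section s.contMDiff⟩

/-- A Lie algebroid structure on the smooth vector bundle `A → M` with model fibre `F`: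
a real Lie algebra structure on the smooth sections and a smooth bundle map `ρ : A → TM`
compatible with the brackets and satisfying the Leibniz identity. -/
structure LieAlgebroid where
  bracket : Cₛ^∞⟮I; F, A⟯ →ₗ[ℝ] Cₛ^∞⟮I; F, A⟯ →ₗ[ℝ] Cₛ^∞⟮I; F, A⟯
  bracket_self : ∀ s, bracket s s = 0
  jacobi : ∀ s t u,
    bracket s (bracket t u) = bracket (bracket s t) u + bracket t (bracket s u)
  anchor : ∀ x : M, A x →L[ℝ] TangentSpace I x
  contMDiff_anchor : ContMDiff I (I.prod 𝓘(ℝ, F →L[ℝ] E)) ∞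
    (fun x => TotalSpace.mk' (F →L[ℝ] E) (E := fun x : M => A x →L[ℝ] TangentSpace I x)
      x (anchor x))
  anchor_bracket : ∀ s t x, anchor x (bracket s t x) =
    VectorField.mlieBracket I (fun y => anchor y (s y)) (fun y => anchor y (t y)) x
  leibniz : ∀ (s : Cₛ^∞⟮I; F, A⟯) (f : C^∞⟮I, M; 𝓘(ℝ, ℝ), ℝ⟯) (t : Cₛ^∞⟮I; F, A⟯) (x : M),
    bracket s (smulSection f t) x
      = f x • bracket s t x + dirDeriv I f x (anchor x (s x)) • t x

/-- A smooth 2-form on the bundle `A`. -/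
structure TwoForm where
  toFun : ∀ x : M, A x →L[ℝ] A x →L[ℝ] ℝ
  alternating : ∀ x v, toFun x v v = 0
  contMDiff : ContMDiff I (I.prod 𝓘(ℝ, F →L[ℝ] F →L[ℝ] ℝ)) ∞
    (fun x => TotalSpace.mk' (F →L[ℝ] F →L[ℝ] ℝ) (E := fun x : M => A x →L[ℝ] A x →L[ℝ] ℝ)
      x (toFun x))

/-- An almost complex structure on the bundle `A`: a smooth endomorphism with `J² = -id`. -/
structure AlmostComplexStructure where
  toFun : ∀ x : M, A x →L[ℝ] A x
  contMDiff : ContMDiff I (I.prod 𝓘(ℝ, F →L[ℝ] F)) ∞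
    (fun x => TotalSpace.mk' (F →L[ℝ] F) (E := fun x : M => A x →L[ℝ] A x) x (toFun x))
  sq_eq_neg : ∀ x v, toFun x (toFun x v) = -v

variable {I F A}

/-- The exterior derivative `d^A η (s₀, s₁, s₂)` of a 2-form, evaluated on smooth sections. -/
def LieAlgebroid.extDeriv (𝒜 : LieAlgebroid I F A) (η : TwoForm I F A)
    (s₀ s₁ s₂ : Cₛ^∞⟮I; F, A⟯) (x : M) : ℝ :=
  dirDeriv I (fun y => η.toFun y (s₁ y) (s₂ y)) x (𝒜.anchor x (s₀ x))
    - dirDeriv I (fun y => η.toFun y (s₀ y) (s₂ y)) x (𝒜.anchor x (s₁ x))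
    + dirDeriv I (fun y => η.toFun y (s₀ y) (s₁ y)) x (𝒜.anchor x (s₂ x))
    - η.toFun x (𝒜.bracket s₀ s₁ x) (s₂ x)
    + η.toFun x (𝒜.bracket s₀ s₂ x) (s₁ x)
    - η.toFun x (𝒜.bracket s₁ s₂ x) (s₀ x)

/-- A 2-form on a Lie algebroid is symplectic if it is closed and nondegenerate. -/
structure LieAlgebroid.IsSymplectic (𝒜 : LieAlgebroid I F A) (η : TwoForm I F A) : Prop where
  closed : ∀ s₀ s₁ s₂ x, 𝒜.extDeriv η s₀ s₁ s₂ x = 0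
  nondegenerate : ∀ x v, (∀ w, η.toFun x v w = 0) → v = 0

/-- A compatible triple `(ω, J, g)` on a Lie algebroid. -/
structure CompatibleTriple (𝒜 : LieAlgebroid I F A) where
  form : TwoForm I F A
  J : AlmostComplexStructure I F A
  g : ContMDiffRiemannianMetric I ∞ F A
  isSymplectic : 𝒜.IsSymplectic form
  g_J_J : ∀ x v w, g.inner x (J.toFun x v) (J.toFun x w) = g.inner x v w
  form_eq : ∀ x v w, form.toFun x v w = g.inner x v (J.toFun x w)

/-- The orthogonal complement of `W` for the bilinear form `B`. -/
def orth {V : Type*} [TopologicalSpace V] [AddCommGroup V] [Module ℝ V]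
    [IsTopologicalAddGroup V] [ContinuousSMul ℝ V]
    (B : V →L[ℝ] V →L[ℝ] ℝ) (W : Submodule ℝ V) : Submodule ℝ V where
  carrier := {v | ∀ w ∈ W, B v w = 0}
  add_mem' {a b} ha hb w hw := by
    rw [map_add, _root_.add_apply, ha w hw, hb w hw, add_zero]
  zero_mem' w _ := by simp
  smul_mem' c a ha w hw := by
    rw [map_smul, _root_.smul_apply, ha w hw, smul_zero]

namespace CompatibleTriple

variable {𝒜 : LieAlgebroid I F A} (T : CompatibleTriple 𝒜) (p : M)

/-- The kernel `L_p` of the anchor. -/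
def L (_T : CompatibleTriple 𝒜) (p : M) : Submodule ℝ (A p) :=
  LinearMap.ker (𝒜.anchor p : A p →ₗ[ℝ] TangentSpace I p)

/-- `L¹ = L ∩ L^ω`. -/
def L1 : Submodule ℝ (A p) := T.L p ⊓ orth (T.form.toFun p) (T.L p)

/-- `L²` is the `g`-orthogonal complement of `L¹` in `L`. -/
def L2 : Submodule ℝ (A p) := T.L p ⊓ orth (T.g.inner p) (T.L1 p)

/-- `E¹ = J(L¹)`. -/
def E1 : Submodule ℝ (A p) := (T.L1 p).map (T.J.toFun p : A p →ₗ[ℝ] A p)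

/-- `E² = (L + E¹)^ω`. -/
def E2 : Submodule ℝ (A p) := orth (T.form.toFun p) (T.L p ⊔ T.E1 p)

/-- The symplectic generalized distribution `Λ = ρ(E² + L¹)`. -/
def Λ : Submodule ℝ (TangentSpace I p) :=
  (T.E2 p ⊔ T.L1 p).map (𝒜.anchor p : A p →ₗ[ℝ] TangentSpace I p)

end CompatibleTriple

end General

section Tangent

variable {E : Type*} [NormedAddCommGroup E] [NormedSpace ℝ E]
  {H : Type*} [TopologicalSpace H] (I : ModelWithCorners ℝ E H)
  (O : Type*) [TopologicalSpace O] [ChartedSpace H O] [IsManifold I ∞ O]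

theorem contMDiff_tangent_id :
    ContMDiff I (I.prod 𝓘(ℝ, E →L[ℝ] E)) ∞
      (fun x => TotalSpace.mk' (E →L[ℝ] E)
        (E := fun x : O => TangentSpace I x →L[ℝ] TangentSpace I x)
        x (ContinuousLinearMap.id ℝ (TangentSpace I x))) := by
  intro x₀
  rw [contMDiffAt_hom_bundle]
  refine ⟨contMDiffAt_id, ?_⟩
  refine (contMDiffAt_const (c := ContinuousLinearMap.id ℝ E)).congr_of_eventuallyEq ?_
  have hb := (trivializationAt E (TangentSpace I : O → Type _) x₀).open_baseSet.mem_nhds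
    (FiberBundle.mem_baseSet_trivializationAt' x₀)
  filter_upwards [hb] with x hx
  ext v
  have h := (trivializationAt E (TangentSpace I : O → Type _) x₀).linearMapAt_symmₗ (R := ℝ) hx v
  simp only [ContinuousLinearMap.inCoordinates, ContinuousLinearMap.id_comp]
  exact h

/-- The tangent bundle as a Lie algebroid: the anchor is the identity and the bracket is the Lie
bracket of vector fields. -/
def tangentLieAlgebroid [FiniteDimensional ℝ E] :
    LieAlgebroid I E (fun x : O => TangentSpace I x) where
  bracket := LinearMap.mk₂ ℝ
    (fun s t => ⟨VectorField.mlieBracket I s t, by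
      have := FiniteDimensional.complete ℝ E
      have : IsManifold I (minSmoothness ℝ 2) O := by
        rw [minSmoothness_of_isRCLikeNormedField]; infer_instance
      have : IsManifold I (((⊤ : ℕ∞) : ℕ∞ω) + 1) O := ‹IsManifold I ∞ O›
      exact ContDiff.mlieBracket_vectorField (n := (⊤ : ℕ∞)) (m := (⊤ : ℕ∞))
        s.contMDiff t.contMDiff (by
          rw [minSmoothness_of_isRCLikeNormedField]; exact le_rfl)⟩)
    (fun s s' t => by
      have := FiniteDimensional.complete ℝ E
      ext x
      exact VectorField.mlieBracket_add_left s.mdifferentiableAt s'.mdifferentiableAt)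
    (fun c s t => by
      have := FiniteDimensional.complete ℝ E
      ext x
      exact VectorField.mlieBracket_const_smul_left s.mdifferentiableAt)
    (fun s t t' => by
      have := FiniteDimensional.complete ℝ E
      ext x
      exact VectorField.mlieBracket_add_right t.mdifferentiableAt t'.mdifferentiableAt)
    (fun c s t => by
      have := FiniteDimensional.complete ℝ E
      ext x
      exact VectorField.mlieBracket_const_smul_right t.mdifferentiableAt)
  bracket_self s := by
    ext x
    simp
  jacobi s t u := by
    have := FiniteDimensional.complete ℝ E
    have : IsManifold I (minSmoothness ℝ 3) O := by
      rw [minSmoothness_of_isRCLikeNormedField]; infer_instance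
    have h2 : minSmoothness ℝ 2 ≤ ∞ := by
      rw [minSmoothness_of_isRCLikeNormedField]; exact WithTop.coe_le_coe.2 (le_top : (2 : ℕ∞) ≤ ⊤)
    ext x
    exact VectorField.leibniz_identity_mlieBracket_apply
      (s.contMDiff.of_le h2 x) (t.contMDiff.of_le h2 x) (u.contMDiff.of_le h2 x)
  anchor x := ContinuousLinearMap.id ℝ (TangentSpace I x)
  contMDiff_anchor := contMDiff_tangent_id I O
  anchor_bracket s t x := rfl
  leibniz s f t x := by
    have := FiniteDimensional.complete ℝ E
    have hf : MDifferentiableAt I 𝓘(ℝ, ℝ) f x := f.contMDiff.mdifferentiable (by simp) x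
    have h := VectorField.mlieBracket_smul_right (V := s) (W := t) hf t.mdifferentiableAt
    exact h.trans (add_comm _ _)

end Tangent

section Submanifold

variable {E : Type*} [NormedAddCommGroup E] [NormedSpace ℝ E]
  {H : Type*} [TopologicalSpace H] {I : ModelWithCorners ℝ E H}
  {M : Type*} [TopologicalSpace M] [ChartedSpace H M] [IsManifold I ∞ M]
  {F : Type*} [NormedAddCommGroup F] [NormedSpace ℝ F]
  {A : M → Type*} [TopologicalSpace (TotalSpace F A)]
  [∀ x, TopologicalSpace (A x)] [∀ x, AddCommGroup (A x)] [∀ x, Module ℝ (A x)]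
  [∀ x, IsTopologicalAddGroup (A x)] [∀ x, ContinuousSMul ℝ (A x)]
  [FiberBundle F A] [VectorBundle ℝ F A]
  {E' : Type*} [NormedAddCommGroup E'] [NormedSpace ℝ E']
  {H' : Type*} [TopologicalSpace H'] (I' : ModelWithCorners ℝ E' H')
  {O : Type*} [TopologicalSpace O] [ChartedSpace H' O]

/-- `ι : O → M` exhibits `O` as an (immersed) integral submanifold of the generalized
distribution `D` on `M`: it is an injective immersion and `T_q O = D_{ι(q)}` for all `q`. -/
structure IsIntegralSubmanifold (D : ∀ p : M, Submodule ℝ (TangentSpace I p)) (ι : O → M) :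
    Prop where
  contMDiff : ContMDiff I' I ∞ ι
  injective : Function.Injective ι
  injective_mfderiv : ∀ q, Function.Injective (mfderiv I' I ι q)
  range_mfderiv : ∀ q, LinearMap.range
    (mfderiv I' I ι q : TangentSpace I' q →ₗ[ℝ] TangentSpace I (ι q)) = D (ι q)

/-- `S = (ω_O, J_O, g_O)` is induced on `O` by the triple `T = (ω, J, g)` along `ι : O → M`:
`ω_O(X, Y) = ω(a, b)` for all `a, b ∈ E² + L¹` with `ρ(a) = X`, `ρ(b) = Y`, and
`J_O(X) = ρ(J a)`, `g_O(X, Y) = g(a, b)` for all `a, b ∈ E²` with `ρ(a) = X`, `ρ(b) = Y`.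
Tangent vectors of `O` are regarded as tangent vectors of `M` through the differential of `ι`. -/
structure IsInducedTriple [IsManifold I' ∞ O] {𝒜 : LieAlgebroid I F A} (T : CompatibleTriple 𝒜)
    (ι : O → M) {ℬ : LieAlgebroid I' E' (fun q : O => TangentSpace I' q)}
    (S : CompatibleTriple ℬ) : Prop where
  form_eq : ∀ (q : O) (X Y : TangentSpace I' q) (a b : A (ι q)),
    a ∈ T.E2 (ι q) ⊔ T.L1 (ι q) → b ∈ T.E2 (ι q) ⊔ T.L1 (ι q) →
    𝒜.anchor (ι q) a = mfderiv I' I ι q X → 𝒜.anchor (ι q) b = mfderiv I' I ι q Y →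
    S.form.toFun q X Y = T.form.toFun (ι q) a b
  J_eq : ∀ (q : O) (X : TangentSpace I' q) (a : A (ι q)), a ∈ T.E2 (ι q) →
    𝒜.anchor (ι q) a = mfderiv I' I ι q X →
    mfderiv I' I ι q (S.J.toFun q X) = 𝒜.anchor (ι q) (T.J.toFun (ι q) a)
  g_eq : ∀ (q : O) (X Y : TangentSpace I' q) (a b : A (ι q)),
    a ∈ T.E2 (ι q) → b ∈ T.E2 (ι q) →
    𝒜.anchor (ι q) a = mfderiv I' I ι q X → 𝒜.anchor (ι q) b = mfderiv I' I ι q Y →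
    S.g.inner q X Y = T.g.inner (ι q) a b

end Submanifold

end CompatTriples

end

/-!
Stability of `L²` under `J` makes `E²` orthogonal to `L = ker ρ` for `g`, so `E²` is stable under
`J` and `ρ` maps it isomorphically onto `Λ`. Inverting `ρ` on `E²` gives a lift `σ` of the tangent
vectors of an integral manifold `O`, and the induced triple can only be the pullback of `(ω, J, g)`
along `σ`.

Since `σ` is the `g`-orthogonal right inverse of `ρ` on `Λ`, it is smooth as soon as `ρ` has locally
constant rank along `O`; only this uses the bracket. A section `s` of `L^ω` has the form
`ω(s, ·) = α ∘ ρ` with `α` a 1-form, and every tangent vector of `O` is the anchor of such a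
section. Since `ρ` intertwines the brackets, the derivative of `ρ` along the anchor of such a
section, read in local frames, is `B ρ + ρ C` with continuous coefficients `B` and `C`. By
Gronwall's inequality, an element of `ker ρ` at one point then extends to nearby points of `O`
inside `ker ρ`.

The form `ω_O` is closed because `dω_O` is tensorial and can hence be evaluated on fields which are
`ι`-related to the anchors of sections of `L^ω`, where `dω_O` becomes `d^A ω = 0`.
-/

noncomputable section

open Filter Topology

namespace CompatTriples

theorem exists_mem_forall_apply_sub_eq_zero {K V : Type*} [Field K] [AddCommGroup V] [Module K V]
    [FiniteDimensional K V] {B : LinearMap.BilinForm K V} (hB : B.IsRefl)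
    (hne : ∀ v, v ≠ 0 → B v v ≠ 0) (W : Submodule K V) (a : V) :
    ∃ w ∈ W, ∀ w' ∈ W, B (a - w) w' = 0 := by
  have hdisj : Disjoint W (B.orthogonal W) :=
    Submodule.disjoint_def.2 fun v hv hv' => by_contra fun hv0 => hne v hv0 (hv' v hv)
  have hcompl := (LinearMap.BilinForm.isCompl_orthogonal_iff_disjoint hB).2 hdisj
  obtain ⟨w, hw, u, hu, rfl⟩ :=
    Submodule.mem_sup.1 (hcompl.sup_eq_top ▸ Submodule.mem_top : a ∈ W ⊔ B.orthogonal W)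
  refine ⟨w, hw, fun w' hw' => ?_⟩
  rw [add_sub_cancel_left]
  exact hB _ _ (hu w' hw')

theorem TwoForm.antisymm {E : Type*} [NormedAddCommGroup E] [NormedSpace ℝ E]
    {H : Type*} [TopologicalSpace H] {I : ModelWithCorners ℝ E H}
    {M : Type*} [TopologicalSpace M] [ChartedSpace H M]
    {F : Type*} [NormedAddCommGroup F] [NormedSpace ℝ F]
    {A : M → Type*} [TopologicalSpace (TotalSpace F A)]
    [∀ x, TopologicalSpace (A x)] [∀ x, AddCommGroup (A x)] [∀ x, Module ℝ (A x)]
    [FiberBundle F A] [VectorBundle ℝ F A] (η : TwoForm I F A) {x : M} (v w : A x) :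
    η.toFun x v w = -η.toFun x w v := by
  have h := η.alternating x (v + w)
  simp only [map_add, add_apply, η.alternating, zero_add, add_zero] at h
  linarith

namespace CompatibleTriple

section Pointwise

variable {E : Type*} [NormedAddCommGroup E] [NormedSpace ℝ E]
  {H : Type*} [TopologicalSpace H] {I : ModelWithCorners ℝ E H}
  {M : Type*} [TopologicalSpace M] [ChartedSpace H M] [IsManifold I ∞ M]
  {F : Type*} [NormedAddCommGroup F] [NormedSpace ℝ F]
  {A : M → Type*} [TopologicalSpace (TotalSpace F A)]
  [∀ x, TopologicalSpace (A x)] [∀ x, AddCommGroup (A x)] [∀ x, Module ℝ (A x)]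
  [∀ x, IsTopologicalAddGroup (A x)] [∀ x, ContinuousSMul ℝ (A x)]
  [FiberBundle F A] [VectorBundle ℝ F A]
  {𝒜 : LieAlgebroid I F A} (T : CompatibleTriple 𝒜) {p : M}

theorem mem_L {a : A p} : a ∈ T.L p ↔ 𝒜.anchor p a = 0 := Iff.rfl

theorem sub_mem_L {a b : A p} (h : 𝒜.anchor p a = 𝒜.anchor p b) : a - b ∈ T.L p :=
  T.mem_L.2 (by rw [map_sub, h, sub_self])

theorem form_J_right (a b : A p) : T.form.toFun p a (T.J.toFun p b) = -T.g.inner p a b := by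
  rw [T.form_eq, T.J.sq_eq_neg, map_neg]

theorem form_J_J (a b : A p) :
    T.form.toFun p (T.J.toFun p a) (T.J.toFun p b) = T.form.toFun p a b := by
  rw [T.form_eq, T.form_eq, T.g_J_J]

theorem eq_zero_of_g_self_eq_zero {a : A p} (h : T.g.inner p a a = 0) : a = 0 := by
  by_contra hne
  exact (T.g.pos p a hne).ne' h

theorem E2_le_orth_L : T.E2 p ≤ orth (T.form.toFun p) (T.L p) :=
  fun _ ha w hw => ha w (Submodule.mem_sup_left hw)

theorem L1_le_L : T.L1 p ≤ T.L p := inf_le_left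

theorem L1_le_orth_L : T.L1 p ≤ orth (T.form.toFun p) (T.L p) := inf_le_right

theorem form_congr_of_anchor_eq {a a' b b' : A p} (ha : a ∈ orth (T.form.toFun p) (T.L p))
    (hb' : b' ∈ orth (T.form.toFun p) (T.L p))
    (h : 𝒜.anchor p a = 𝒜.anchor p a') (h' : 𝒜.anchor p b = 𝒜.anchor p b') :
    T.form.toFun p a b = T.form.toFun p a' b' := by
  have hright : T.form.toFun p a (b - b') = 0 := ha _ (T.sub_mem_L h')
  have hleft : T.form.toFun p (a - a') b' = 0 := by
    rw [T.form.antisymm, hb' _ (T.sub_mem_L h), neg_zero]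
  rw [map_sub, sub_eq_zero] at hright
  rw [map_sub, sub_apply, sub_eq_zero] at hleft
  rw [hright, hleft]

theorem exists_form_eq_comp_anchor {a : A p} (ha : a ∈ orth (T.form.toFun p) (T.L p)) :
    ∃ ξ : TangentSpace I p →ₗ[ℝ] ℝ, ∀ b, T.form.toFun p a b = ξ (𝒜.anchor p b) := by
  have hmem : (T.form.toFun p a : A p →ₗ[ℝ] ℝ) ∈
      (LinearMap.ker (𝒜.anchor p : A p →ₗ[ℝ] TangentSpace I p)).dualAnnihilator := by
    rw [Submodule.mem_dualAnnihilator]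
    exact fun w hw => ha w hw
  rw [← LinearMap.range_dualMap_eq_dualAnnihilator_ker] at hmem
  obtain ⟨ξ, hξ⟩ := hmem
  exact ⟨ξ, fun b => (LinearMap.congr_fun hξ b).symm⟩

variable [FiniteDimensional ℝ F]

theorem exists_g_projection (W : Submodule ℝ (A p)) (a : A p) :
    ∃ w ∈ W, ∀ w' ∈ W, T.g.inner p (a - w) w' = 0 := by
  have : FiniteDimensional ℝ (A p) := VectorBundle.finiteDimensional ℝ F A p
  exact exists_mem_forall_apply_sub_eq_zero
    (B := LinearMap.mk₂ ℝ (fun v w => T.g.inner p v w) (by simp) (by simp) (by simp) (by simp))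
    (fun v w h => (T.g.symm p w v).trans h) (fun v hv => (T.g.pos p v hv).ne') W a

theorem exists_sub_mem_E2 {a : A p} (ha : a ∈ orth (T.form.toFun p) (T.L p)) :
    ∃ l ∈ T.L1 p, a - l ∈ T.E2 p := by
  obtain ⟨l, hl, hperp⟩ := T.exists_g_projection (T.L1 p) a
  refine ⟨l, hl, fun w hw => ?_⟩
  obtain ⟨w₁, hw₁, w₂, ⟨l', hl', rfl⟩, rfl⟩ := Submodule.mem_sup.1 hw
  have hL : T.form.toFun p (a - l) w₁ = 0 := by
    rw [map_sub, sub_apply, ha _ hw₁, T.L1_le_orth_L hl _ hw₁, sub_zero]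
  have hE1 : T.form.toFun p (a - l) (T.J.toFun p l') = 0 := by
    rw [form_J_right, hperp _ hl', neg_zero]
  rw [map_add, hL, zero_add]
  exact hE1

theorem E2_sup_L1 : T.E2 p ⊔ T.L1 p = orth (T.form.toFun p) (T.L p) := by
  apply le_antisymm (sup_le T.E2_le_orth_L T.L1_le_orth_L)
  intro a ha
  obtain ⟨l, hl, h⟩ := T.exists_sub_mem_E2 ha
  exact Submodule.mem_sup.2 ⟨a - l, h, l, hl, sub_add_cancel _ _⟩

theorem mem_Λ {v : TangentSpace I p} :
    v ∈ T.Λ p ↔ ∃ a ∈ orth (T.form.toFun p) (T.L p), 𝒜.anchor p a = v := by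
  rw [Λ, E2_sup_L1]
  rfl

theorem exists_mem_E2_anchor_eq {v : TangentSpace I p} (hv : v ∈ T.Λ p) :
    ∃ a ∈ T.E2 p, 𝒜.anchor p a = v := by
  obtain ⟨a, ha, rfl⟩ := T.mem_Λ.1 hv
  obtain ⟨l, hl, h⟩ := T.exists_sub_mem_E2 ha
  refine ⟨a - l, h, ?_⟩
  rw [map_sub, T.mem_L.1 (T.L1_le_L hl), sub_zero]

variable {T}

theorem g_eq_zero_of_mem_E2_of_mem_L (hJ : ∀ a ∈ T.L2 p, T.J.toFun p a ∈ T.L2 p) {e l : A p}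
    (he : e ∈ T.E2 p) (hl : l ∈ T.L p) : T.g.inner p e l = 0 := by
  obtain ⟨l₁, hl₁, hperp⟩ := T.exists_g_projection (T.L1 p) l
  have hL1 : T.g.inner p e l₁ = 0 := by
    have h : T.form.toFun p e (T.J.toFun p l₁) = 0 :=
      he _ (Submodule.mem_sup_right ⟨l₁, hl₁, rfl⟩)
    rwa [form_J_right, neg_eq_zero] at h
  have hL2 : T.g.inner p e (l - l₁) = 0 := by
    have hmem : l - l₁ ∈ T.L2 p := ⟨Submodule.sub_mem _ hl (T.L1_le_L hl₁), hperp⟩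
    have h := he _ (Submodule.mem_sup_left (hJ _ hmem).1)
    rwa [form_J_right, neg_eq_zero] at h
  rwa [map_sub, hL1, sub_zero] at hL2

theorem J_mem_E2 (hJ : ∀ a ∈ T.L2 p, T.J.toFun p a ∈ T.L2 p) {e : A p}
    (he : e ∈ T.E2 p) : T.J.toFun p e ∈ T.E2 p := by
  intro w hw
  obtain ⟨w₁, hw₁, w₂, ⟨l, hl, rfl⟩, rfl⟩ := Submodule.mem_sup.1 hw
  have hL : T.form.toFun p (T.J.toFun p e) w₁ = 0 := by
    rw [T.form_eq, T.g_J_J, g_eq_zero_of_mem_E2_of_mem_L hJ he hw₁]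
  have hE1 : T.form.toFun p (T.J.toFun p e) (T.J.toFun p l) = 0 := by
    rw [form_J_J]
    exact T.E2_le_orth_L he _ (T.L1_le_L hl)
  rw [map_add, hL, zero_add]
  exact hE1

theorem eq_of_mem_E2_of_anchor_eq (hJ : ∀ a ∈ T.L2 p, T.J.toFun p a ∈ T.L2 p) {a b : A p}
    (ha : a ∈ T.E2 p) (hb : b ∈ T.E2 p) (h : 𝒜.anchor p a = 𝒜.anchor p b) : a = b :=
  sub_eq_zero.1 <| T.eq_zero_of_g_self_eq_zero <|
    g_eq_zero_of_mem_E2_of_mem_L hJ (Submodule.sub_mem _ ha hb) (T.sub_mem_L h)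

end Pointwise

end CompatibleTriple

theorem exists_comp_comp_eq_self {K V W : Type*} [DivisionRing K] [AddCommGroup V] [Module K V]
    [AddCommGroup W] [Module K W] (f : V →ₗ[K] W) : ∃ g : W →ₗ[K] V, f ∘ₗ g ∘ₗ f = f := by
  obtain ⟨h, hh⟩ := f.rangeRestrict.exists_rightInverse_of_surjective f.range_rangeRestrict
  obtain ⟨g, hg⟩ := h.exists_extend
  refine ⟨g, LinearMap.ext fun v => ?_⟩
  have hgv : g (f v) = h (f.rangeRestrict v) := LinearMap.congr_fun hg (f.rangeRestrict v)
  rw [LinearMap.comp_apply, LinearMap.comp_apply, hgv]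
  exact congrArg Subtype.val (LinearMap.congr_fun hh (f.rangeRestrict v))

theorem eventually_eq_zero_of_norm_fderiv_le {E G : Type*} [NormedAddCommGroup E]
    [NormedSpace ℝ E] [NormedAddCommGroup G] [NormedSpace ℝ G] {h : E → G} {x₀ : E} {K : ℝ}
    (h₀ : h x₀ = 0) (hd : ∀ᶠ x in 𝓝 x₀, DifferentiableAt ℝ h x)
    (hK : ∀ᶠ x in 𝓝 x₀, ∀ u, ‖fderiv ℝ h x u‖ ≤ K * ‖u‖ * ‖h x‖) :
    ∀ᶠ x in 𝓝 x₀, h x = 0 := by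
  obtain ⟨r, hr, hball⟩ := Metric.eventually_nhds_iff_ball.1 (hd.and hK)
  refine Metric.eventually_nhds_iff_ball.2 ⟨r, hr, fun x hx => ?_⟩
  have hmem : ∀ t ∈ Set.Icc (0 : ℝ) 1, x₀ + t • (x - x₀) ∈ Metric.ball x₀ r := fun t ht =>
    (convex_ball x₀ r).add_smul_sub_mem (Metric.mem_ball_self hr) hx ht
  have hderiv : ∀ t ∈ Set.Icc (0 : ℝ) 1, HasDerivAt (fun t : ℝ => h (x₀ + t • (x - x₀)))
      (fderiv ℝ h (x₀ + t • (x - x₀)) (x - x₀)) t := by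
    intro t ht
    have hsegment : HasDerivAt (fun t : ℝ => x₀ + t • (x - x₀)) (x - x₀) t := by
      simpa using ((hasDerivAt_id t).smul_const (x - x₀)).const_add x₀
    exact ((hball _ (hmem t ht)).1.hasFDerivAt).comp_hasDerivAt t hsegment
  have hzero := eq_zero_of_abs_deriv_le_mul_abs_self_of_eq_zero_right
    (f := fun t : ℝ => h (x₀ + t • (x - x₀))) (K := K * ‖x - x₀‖) (a := 0) (b := 1)
    (fun t ht => (hderiv t ht).continuousAt.continuousWithinAt)
    (fun t ht => (hderiv t (Set.Ico_subset_Icc_self ht)).hasDerivWithinAt) (by simpa using h₀)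
    (fun t ht => (hball _ (hmem t (Set.Ico_subset_Icc_self ht))).2 (x - x₀)) 1
    (Set.right_mem_Icc.2 zero_le_one)
  simpa using hzero

section KerExtension

variable {E F : Type*} [NormedAddCommGroup E] [NormedSpace ℝ E]
  [NormedAddCommGroup F] [NormedSpace ℝ F]

/-- If `R₀ Q R₀ = R₀`, an endomorphism of the domain depending smoothly on the operator `R` near
`R₀`, which for `R = R₀` is the projection `1 - Q R₀` onto the kernel of `R₀`. It takes values in
the kernel of `R` as long as the rank of `R` is that of `R₀`, and is then a smooth extension of the
projection onto the kernel. -/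
def kerExtension (Q : E →L[ℝ] F) (R₀ R : F →L[ℝ] E) : F →L[ℝ] F :=
  Ring.inverse (1 + Q ∘L (R - R₀)) ∘L (1 - Q ∘L R₀)

variable {Q : E →L[ℝ] F} {R₀ R : F →L[ℝ] E}

theorem kerExtension_self : kerExtension Q R₀ R₀ = 1 - Q ∘L R₀ := by
  rw [kerExtension, sub_self, ContinuousLinearMap.comp_zero, add_zero, Ring.inverse_one]
  rfl

theorem kerExtension_eq_one_sub (h : IsUnit (1 + Q ∘L (R - R₀))) :
    kerExtension Q R₀ R = 1 - Ring.inverse (1 + Q ∘L (R - R₀)) ∘L Q ∘L R := by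
  have hsub : 1 - Q ∘L R₀ = (1 + Q ∘L (R - R₀)) - Q ∘L R := by
    rw [ContinuousLinearMap.comp_sub]
    abel
  rw [kerExtension, hsub, ContinuousLinearMap.comp_sub, ← ContinuousLinearMap.mul_def,
    Ring.inverse_mul_cancel _ h]

theorem comp_kerExtension (h : IsUnit (1 + Q ∘L (R - R₀))) :
    R ∘L kerExtension Q R₀ R =
      (1 - R ∘L Ring.inverse (1 + Q ∘L (R - R₀)) ∘L Q) ∘L R := by
  rw [kerExtension_eq_one_sub h, ContinuousLinearMap.comp_sub, ContinuousLinearMap.sub_comp]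
  rfl

variable [CompleteSpace F]

theorem contDiffAt_ringInverse_one_add_comp_sub {n : ℕ∞ω} (h : IsUnit (1 + Q ∘L (R - R₀))) :
    ContDiffAt ℝ n (fun R => Ring.inverse (1 + Q ∘L (R - R₀))) R := by
  obtain ⟨τ, hτ⟩ := h
  exact ContDiffAt.comp (g := Ring.inverse) R (hτ ▸ contDiffAt_ringInverse ℝ τ) (by fun_prop)

theorem contDiffAt_kerExtension {n : ℕ∞ω} (h : IsUnit (1 + Q ∘L (R - R₀))) :
    ContDiffAt ℝ n (kerExtension Q R₀) R :=
  (contDiffAt_ringInverse_one_add_comp_sub h).clm_comp contDiffAt_const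

theorem hasFDerivAt_comp_kerExtension (h : IsUnit (1 + Q ∘L (R - R₀))) :
    HasFDerivAt (fun R => R ∘L kerExtension Q R₀ R)
      (ContinuousLinearMap.compL ℝ F E E (1 - R ∘L Ring.inverse (1 + Q ∘L (R - R₀)) ∘L Q) ∘L
        (ContinuousLinearMap.compL ℝ F F E).flip (kerExtension Q R₀ R)) R := by
  obtain ⟨τ, hτ⟩ := h
  have hadd : HasFDerivAt (fun R => 1 + Q ∘L (R - R₀)) (ContinuousLinearMap.compL ℝ F E F Q) R :=
    (((ContinuousLinearMap.compL ℝ F E F Q).hasFDerivAt).comp R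
      ((hasFDerivAt_id R).sub_const R₀)).const_add 1
  have hinv : HasFDerivAt (fun R => Ring.inverse (1 + Q ∘L (R - R₀))) _ R :=
    HasFDerivAt.comp (g := Ring.inverse) R (hτ ▸ hasFDerivAt_ringInverse (𝕜 := ℝ) τ) hadd
  have hV := hinv.clm_comp (hasFDerivAt_const (1 - Q ∘L R₀) R)
  refine ((hasFDerivAt_id R).clm_comp hV).congr_fderiv ?_
  refine ContinuousLinearMap.ext fun X => ?_
  have hσ : Ring.inverse (1 + Q ∘L (R - R₀)) = ↑τ⁻¹ := by rw [← hτ, Ring.inverse_unit]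
  rw [kerExtension, hσ]
  generalize (↑τ⁻¹ : F →L[ℝ] F) = σ
  ext v
  simp only [ContinuousLinearMap.comp_apply, add_apply, sub_apply, neg_apply,
    ContinuousLinearMap.compL_apply, ContinuousLinearMap.flip_apply, zero_apply, map_zero,
    ContinuousLinearMap.mulLeftRight_apply, mul_apply_eq_comp, one_apply_eq_self,
    ContinuousLinearMap.id_apply, id]
  rw [zero_add, map_neg]
  abel

theorem eventually_isUnit_one_add_comp_sub (Q : E →L[ℝ] F) (R₀ : F →L[ℝ] E) :
    ∀ᶠ R in 𝓝 R₀, IsUnit (1 + Q ∘L (R - R₀)) := by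
  have hcont : ContinuousAt (fun R => 1 + Q ∘L (R - R₀)) R₀ := by fun_prop
  exact hcont.eventually (Units.isOpen.mem_nhds (by simp))

end KerExtension

theorem eventually_mem_baseSet {M : Type*} [TopologicalSpace M] {F : Type*} [TopologicalSpace F]
    {A : M → Type*} [TopologicalSpace (TotalSpace F A)] [∀ x, TopologicalSpace (A x)]
    [FiberBundle F A] (p : M) : ∀ᶠ x in 𝓝 p, x ∈ (trivializationAt F A p).baseSet :=
  (trivializationAt F A p).open_baseSet.mem_nhds (FiberBundle.mem_baseSet_trivializationAt F A p)

section Frame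

variable {M : Type*} [TopologicalSpace M]
  {F : Type*} [NormedAddCommGroup F] [NormedSpace ℝ F]
  {A : M → Type*} [TopologicalSpace (TotalSpace F A)] [∀ x, TopologicalSpace (A x)]
  [∀ x, AddCommGroup (A x)] [∀ x, Module ℝ (A x)] [FiberBundle F A] [VectorBundle ℝ F A]

variable (F A) in
/-- The local frame of a vector bundle given by the preferred trivialization at `p`, as a map from
the model fibre to the fibre at `x`. -/
def frame (p x : M) : F →L[ℝ] A x := (trivializationAt F A p).symmL ℝ x

variable (F A) in
/-- The coordinates on the fibre at `x` dual to the local frame at `p`. -/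
def coframe (p x : M) : A x →L[ℝ] F := (trivializationAt F A p).continuousLinearMapAt ℝ x

variable {p x : M}

theorem frame_coframe (hx : x ∈ (trivializationAt F A p).baseSet) (a : A x) :
    frame F A p x (coframe F A p x a) = a :=
  (trivializationAt F A p).symmL_continuousLinearMapAt hx a

theorem coframe_frame (hx : x ∈ (trivializationAt F A p).baseSet) (u : F) :
    coframe F A p x (frame F A p x u) = u :=
  (trivializationAt F A p).continuousLinearMapAt_symmL hx u

theorem coframe_injective (hx : x ∈ (trivializationAt F A p).baseSet) :
    Function.Injective (coframe F A p x) :=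
  Function.LeftInverse.injective (frame_coframe hx)

theorem trivializationAt_snd_eq_coframe (hx : x ∈ (trivializationAt F A p).baseSet) (a : A x) :
    (trivializationAt F A p ⟨x, a⟩).2 = coframe F A p x a :=
  (Trivialization.continuousLinearMapAt_apply_of_mem ℝ (trivializationAt F A p) hx a).symm

theorem inCoordinates_bilin_apply (hx : x ∈ (trivializationAt F A p).baseSet)
    (B : A x →L[ℝ] A x →L[ℝ] ℝ) (u v : F) :
    ContinuousLinearMap.inCoordinates F A (F →L[ℝ] ℝ) (fun x => A x →L[ℝ] ℝ) p x p x B u v =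
      B (frame F A p x u) (frame F A p x v) := by
  rw [inCoordinates_apply_eq₂ (E₃ := fun _ : M => ℝ) (F₃ := ℝ) hx hx (Set.mem_univ x)]
  simp [frame, hx]

variable {E : Type*} [NormedAddCommGroup E] [NormedSpace ℝ E]
  {H : Type*} [TopologicalSpace H] {I : ModelWithCorners ℝ E H} [ChartedSpace H M]

theorem contMDiffAt_section_iff_coframe {n : ℕ∞ω} {s : ∀ x, A x} :
    ContMDiffAt I (I.prod 𝓘(ℝ, F)) n (fun x => TotalSpace.mk' F x (s x)) p ↔
      ContMDiffAt I 𝓘(ℝ, F) n (fun x => coframe F A p x (s x)) p := by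
  rw [Bundle.contMDiffAt_section]
  exact Filter.EventuallyEq.contMDiffAt_iff ((eventually_mem_baseSet p).mono fun x hx =>
    trivializationAt_snd_eq_coframe hx _)

theorem mdifferentiableAt_section_iff_coframe {s : ∀ x, A x} :
    MDifferentiableAt I (I.prod 𝓘(ℝ, F)) (fun x => TotalSpace.mk' F x (s x)) p ↔
      MDifferentiableAt I 𝓘(ℝ, F) (fun x => coframe F A p x (s x)) p := by
  rw [mdifferentiableAt_section]
  exact Filter.EventuallyEq.mdifferentiableAt_iff ((eventually_mem_baseSet p).mono fun x hx =>
    trivializationAt_snd_eq_coframe hx _)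

variable [IsManifold I ∞ M] [FiniteDimensional ℝ E] [T2Space M]

variable (I) in
theorem exists_section_eventuallyEq_frame [ContMDiffVectorBundle ∞ F A I] (p : M) (u : F) :
    ∃ s : Cₛ^∞⟮I; F, A⟯, ∀ᶠ x in 𝓝 p, s x = frame F A p x u := by
  obtain ⟨χ, -, hχ⟩ := (SmoothBumpFunction.nhds_basis_tsupport (I := I) p).mem_iff.1
    (eventually_mem_baseSet (F := F) (A := A) p)
  have hframe : ContMDiffOn I (I.prod 𝓘(ℝ, F)) ∞ (fun x => TotalSpace.mk' F x (frame F A p x u))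
      (trivializationAt F A p).baseSet := by
    rw [(trivializationAt F A p).contMDiffOn_section_baseSet_iff]
    refine (contMDiffOn_const (c := u)).congr fun x hx => ?_
    rw [trivializationAt_snd_eq_coframe hx, coframe_frame hx]
  refine ⟨⟨_, ContMDiffOn.smul_section_of_tsupport χ.contMDiff.contMDiffOn
    (trivializationAt F A p).open_baseSet hχ hframe⟩, ?_⟩
  filter_upwards [χ.eventuallyEq_one] with x hx
  change χ x • frame F A p x u = _
  rw [hx, Pi.one_apply, one_smul]

end Frame

section Derivative

variable {E : Type*} [NormedAddCommGroup E] [NormedSpace ℝ E]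
  {H : Type*} [TopologicalSpace H] {I : ModelWithCorners ℝ E H}
  {M : Type*} [TopologicalSpace M] [ChartedSpace H M]
  {G : Type*} [NormedAddCommGroup G] [NormedSpace ℝ G]
  {G' : Type*} [NormedAddCommGroup G'] [NormedSpace ℝ G']

theorem mvfderiv_clm_comp_apply (L : G →L[ℝ] G') {f : M → G} {x : M}
    (hf : MDifferentiableAt I 𝓘(ℝ, G) f x) (v : TangentSpace I x) :
    mvfderiv I (fun y => L (f y)) x v = L (mvfderiv I f x v) :=
  DFunLike.congr_fun ((L.hasMFDerivAt (x := f x)).comp x hf.hasMFDerivAt).mfderiv v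

theorem tendsto_extChartAt_symm (x : M) :
    Tendsto (extChartAt I x).symm (𝓝 (extChartAt I x x)) (𝓝 x) := by
  simpa only [ContinuousAt, extChartAt_to_inv] using continuousAt_extChartAt_symm (I := I) x

variable [IsManifold I ∞ M]

theorem eventually_mdifferentiableAt_of_contMDiffAt {E' : Type*} [NormedAddCommGroup E']
    [NormedSpace ℝ E'] {H' : Type*} [TopologicalSpace H'] {I' : ModelWithCorners ℝ E' H'}
    {N : Type*} [TopologicalSpace N] [ChartedSpace H' N] [IsManifold I' 1 N] {f : M → N} {x : M}
    (hf : ContMDiffAt I I' ∞ f x) : ∀ᶠ y in 𝓝 x, MDifferentiableAt I I' f y := by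
  have : IsManifold I 1 M := IsManifold.of_le (n := ∞) (by norm_cast)
  have hf₁ : ContMDiffAt I I' 1 f x := hf.of_le (by norm_cast)
  exact ((contMDiffAt_iff_contMDiffAt_nhds (by simp)).1 hf₁).mono fun y hy =>
    hy.mdifferentiableAt one_ne_zero

theorem coframe_tangent {p x : M} (hx : x ∈ (chartAt H p).source) :
    coframe E (TangentSpace I) p x = mvfderiv I (extChartAt I p) x := by
  have : IsManifold I 1 M := IsManifold.of_le (n := ∞) (by norm_cast)
  exact TangentBundle.continuousLinearMapAt_trivializationAt hx

theorem contMDiffAt_mvfderiv_frame {f : M → G} {x : M} (hf : ContMDiffAt I 𝓘(ℝ, G) ∞ f x) :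
    ContMDiffAt I 𝓘(ℝ, E →L[ℝ] G) ∞
      (fun y => mvfderiv I f y ∘L frame E (TangentSpace I) x y) x := by
  refine (ContMDiffAt.mfderiv_const (m := ∞) hf (by simp)).congr_of_eventuallyEq
    (Eventually.of_forall fun y => ContinuousLinearMap.ext fun u => ?_)
  have hid : coframe G (TangentSpace 𝓘(ℝ, G)) (f x) (f y) = (1 : G →L[ℝ] G) :=
    TangentBundle.continuousLinearMapAt_model_space _ _
  exact (DFunLike.congr_fun hid (mvfderiv I f y (frame E (TangentSpace I) x y u))).symm

theorem exists_contMDiff_mvfderiv_eq [FiniteDimensional ℝ E] [T2Space M] (p : M)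
    (ξ : TangentSpace I p →L[ℝ] ℝ) : ∃ f : C^∞⟮I, M; 𝓘(ℝ, ℝ), ℝ⟯, mvfderiv I f p = ξ := by
  obtain ⟨χ⟩ : Nonempty (SmoothBumpFunction I p) := inferInstance
  set ξ' : E →L[ℝ] ℝ := ξ ∘L frame E (TangentSpace I) p p
  have hξ' : ContMDiffOn I 𝓘(ℝ, ℝ) ∞ (fun x => ξ' (extChartAt I p x)) (chartAt H p).source :=
    ξ'.contMDiff.comp_contMDiffOn contMDiffOn_extChartAt
  refine ⟨⟨fun x => χ x • ξ' (extChartAt I p x), χ.contMDiff_smul hξ'⟩, ?_⟩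
  have heq : (fun x => χ x • ξ' (extChartAt I p x)) =ᶠ[𝓝 p] fun x => ξ' (extChartAt I p x) := by
    filter_upwards [χ.eventuallyEq_one] with x hx
    rw [hx, Pi.one_apply, one_smul]
  have hchart : MDifferentiableAt I 𝓘(ℝ, E) (extChartAt I p) p :=
    mdifferentiableAt_extChartAt (mem_chart_source H p)
  ext v
  refine (DFunLike.congr_fun heq.mfderiv_eq v).trans
    ((mvfderiv_clm_comp_apply ξ' hchart v).trans ?_)
  rw [← coframe_tangent (mem_chart_source H p)]
  exact congrArg ξ (frame_coframe (FiberBundle.mem_baseSet_trivializationAt' p) v)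

variable [I.Boundaryless]

theorem mdifferentiableAt_extChartAt_symm {x : M} {y : E} (hy : y ∈ (extChartAt I x).target) :
    MDifferentiableAt 𝓘(ℝ, E) I (extChartAt I x).symm y :=
  ((contMDiffOn_extChartAt_symm x).contMDiffAt
    ((isOpen_extChartAt_target x).mem_nhds hy)).mdifferentiableAt (n := ∞) (by simp)

theorem fderiv_comp_extChartAt_symm {f : M → G} {x : M} {y : E}
    (hy : y ∈ (extChartAt I x).target)
    (hf : MDifferentiableAt I 𝓘(ℝ, G) f ((extChartAt I x).symm y)) (u : E) :
    fderiv ℝ (f ∘ (extChartAt I x).symm) y u =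
      mvfderiv I f ((extChartAt I x).symm y)
        (mfderiv 𝓘(ℝ, E) I (extChartAt I x).symm y u) := by
  rw [← mfderiv_eq_fderiv, mfderiv_comp y hf (mdifferentiableAt_extChartAt_symm hy)]
  rfl

theorem frame_tangent {p : M} {y : E} (hy : y ∈ (extChartAt I p).target) :
    frame E (TangentSpace I) p ((extChartAt I p).symm y) =
      mfderiv 𝓘(ℝ, E) I (extChartAt I p).symm y := by
  have : IsManifold I 1 M := IsManifold.of_le (n := ∞) (by norm_cast)
  have hsource := (extChartAt I p).map_target hy
  rw [extChartAt_source] at hsource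
  have h := TangentBundle.symmL_trivializationAt (I := I) hsource
  rwa [(extChartAt I p).right_inv hy, I.range_eq_univ, mfderivWithin_univ] at h

theorem eventually_eq_zero_of_norm_mvfderiv_le {h : M → G} {p : M} {K : ℝ} (h₀ : h p = 0)
    (hd : ∀ᶠ x in 𝓝 p, MDifferentiableAt I 𝓘(ℝ, G) h x)
    (hK : ∀ᶠ x in 𝓝 p, ∀ u : E,
      ‖mvfderiv I h x (frame E (TangentSpace I) p x u)‖ ≤ K * ‖u‖ * ‖h x‖) :
    ∀ᶠ x in 𝓝 p, h x = 0 := by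
  have hsymm := tendsto_extChartAt_symm (I := I) p
  have htarget := extChartAt_target_mem_nhds (I := I) p
  have hzero : ∀ᶠ y in 𝓝 (extChartAt I p p), (h ∘ (extChartAt I p).symm) y = 0 := by
    refine eventually_eq_zero_of_norm_fderiv_le (K := K) (by simpa using h₀) ?_ ?_
    · filter_upwards [hsymm.eventually hd, htarget] with y hdy hy
      exact (hdy.comp y (mdifferentiableAt_extChartAt_symm hy)).differentiableAt
    · filter_upwards [hsymm.eventually hd, hsymm.eventually hK, htarget] with y hdy hKy hy u
      rw [fderiv_comp_extChartAt_symm hy hdy, ← frame_tangent hy]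
      exact hKy u
  filter_upwards [(continuousAt_extChartAt (I := I) p).eventually hzero,
    extChartAt_source_mem_nhds (I := I) p] with x hx hxs
  simpa only [Function.comp_apply, (extChartAt I p).left_inv hxs] using hx

end Derivative

section Commutator

variable {E : Type*} [NormedAddCommGroup E] [NormedSpace ℝ E]
  {G : Type*} [NormedAddCommGroup G] [NormedSpace ℝ G]

open VectorField

theorem fderiv_lieBracket {ψ : E → G} {x : E} (hψ : ContDiffAt ℝ 2 ψ x) {V W : E → E}
    (hV : DifferentiableAt ℝ V x) (hW : DifferentiableAt ℝ W x) :
    fderiv ℝ ψ x (lieBracket ℝ V W x) =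
      fderiv ℝ (fun y => fderiv ℝ ψ y (W y)) x (V x) -
        fderiv ℝ (fun y => fderiv ℝ ψ y (V y)) x (W x) := by
  have hψ' : DifferentiableAt ℝ (fderiv ℝ ψ) x :=
    (hψ.fderiv_right (m := 1) one_add_one_eq_two.le).differentiableAt one_ne_zero
  have hsymm : IsSymmSndFDerivAt ℝ ψ x :=
    hψ.isSymmSndFDerivAt minSmoothness_of_isRCLikeNormedField.le
  have hswap : fderiv ℝ (fderiv ℝ ψ) x (V x) (W x) = fderiv ℝ (fderiv ℝ ψ) x (W x) (V x) :=
    hsymm.eq _ _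
  rw [fderiv_clm_apply hψ' hW, fderiv_clm_apply hψ' hV, lieBracket_eq, map_sub]
  simp only [add_apply, ContinuousLinearMap.comp_apply, ContinuousLinearMap.flip_apply, hswap]
  abel

variable {H : Type*} [TopologicalSpace H] {I : ModelWithCorners ℝ E H}
  {M : Type*} [TopologicalSpace M] [ChartedSpace H M]

variable (I) in
/-- The vector field `V` read in the chart at `x`. -/
def chartField (x : M) (V : Π y : M, TangentSpace I y) : E → E :=
  mpullback 𝓘(ℝ, E) I (extChartAt I x).symm V

variable [I.Boundaryless] [IsManifold I ∞ M]

theorem mfderiv_extChartAt_symm_chartField {x : M} {y : E} (hy : y ∈ (extChartAt I x).target)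
    (V : Π y : M, TangentSpace I y) :
    mfderiv 𝓘(ℝ, E) I (extChartAt I x).symm y ((chartField I x V : E → E) y) =
      V ((extChartAt I x).symm y) := by
  have : IsManifold I 1 M := IsManifold.of_le (n := ∞) (by norm_cast)
  have hinv := isInvertible_mfderivWithin_extChartAt_symm (I := I) hy
  rw [I.range_eq_univ, mfderivWithin_univ] at hinv
  exact hinv.self_apply_inverse _

theorem fderiv_comp_extChartAt_symm_chartField {f : M → G} {x : M} {y : E}
    (hy : y ∈ (extChartAt I x).target)
    (hf : MDifferentiableAt I 𝓘(ℝ, G) f ((extChartAt I x).symm y))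
    (V : Π y : M, TangentSpace I y) :
    fderiv ℝ (f ∘ (extChartAt I x).symm) y (chartField I x V y) =
      mvfderiv I f ((extChartAt I x).symm y) (V ((extChartAt I x).symm y)) := by
  rw [fderiv_comp_extChartAt_symm hy hf, mfderiv_extChartAt_symm_chartField hy]

theorem fderiv_fderiv_comp_extChartAt_symm_chartField {f a : M → G} {x : M}
    (hf : ContMDiffAt I 𝓘(ℝ, G) ∞ f x) (ha : MDifferentiableAt I 𝓘(ℝ, G) a x)
    {V : Π y : M, TangentSpace I y} (hVa : ∀ᶠ y in 𝓝 x, mvfderiv I f y (V y) = a y)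
    (W : Π y : M, TangentSpace I y) :
    fderiv ℝ (fun y => fderiv ℝ (f ∘ (extChartAt I x).symm) y (chartField I x V y))
        (extChartAt I x x) (chartField I x W (extChartAt I x x)) =
      mvfderiv I a x (W x) := by
  have hsymm := tendsto_extChartAt_symm (I := I) x
  have heq : (fun y => fderiv ℝ (f ∘ (extChartAt I x).symm) y (chartField I x V y))
      =ᶠ[𝓝 (extChartAt I x x)] a ∘ (extChartAt I x).symm := by
    filter_upwards [hsymm.eventually (eventually_mdifferentiableAt_of_contMDiffAt hf),
      hsymm.eventually hVa, extChartAt_target_mem_nhds x] with y hfy hVy hy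
    rw [fderiv_comp_extChartAt_symm_chartField hy hfy, hVy, Function.comp_apply]
  rw [heq.fderiv_eq, fderiv_comp_extChartAt_symm_chartField (mem_extChartAt_target x)
    (by rwa [extChartAt_to_inv]), extChartAt_to_inv]

variable [CompleteSpace E]

theorem differentiableAt_chartField {x : M} {V : Π y : M, TangentSpace I y}
    (hV : MDiffAt (T% V) x) :
    DifferentiableAt ℝ (chartField I x V) (extChartAt I x x) := by
  have : IsManifold I 2 M := IsManifold.of_le (n := ∞) (WithTop.coe_le_coe.2 le_top)
  rw [← mdifferentiableWithinAt_univ] at hV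
  have h := hV.differentiableWithinAt_mpullbackWithin_vectorField
  simp only [I.range_eq_univ, Set.preimage_univ, Set.inter_self, mpullbackWithin_univ] at h
  exact differentiableWithinAt_univ.1 h

theorem chartField_mlieBracket {x : M} {V W : Π y : M, TangentSpace I y}
    (hV : MDiffAt (T% V) x) (hW : MDiffAt (T% W) x) :
    chartField I x (mlieBracket I V W) (extChartAt I x x) =
      lieBracket ℝ (chartField I x V) (chartField I x W) (extChartAt I x x) := by
  have hsmooth : minSmoothness ℝ 2 ≤ (∞ : ℕ∞ω) := by
    rw [minSmoothness_of_isRCLikeNormedField]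
    exact WithTop.coe_le_coe.2 le_top
  have : IsManifold I (minSmoothness ℝ 2) M := IsManifold.of_le (n := ∞) hsmooth
  rw [chartField, mpullback_mlieBracket (n := ∞) (by rwa [extChartAt_to_inv])
    (by rwa [extChartAt_to_inv])
    ((contMDiffOn_extChartAt_symm x).contMDiffAt (extChartAt_target_mem_nhds x)) hsmooth,
    ← mlieBracketWithin_univ, mlieBracketWithin_eq_lieBracketWithin]
  exact congrFun lieBracketWithin_univ _

theorem mvfderiv_mlieBracket {f a b : M → G} {x : M} (hf : ContMDiffAt I 𝓘(ℝ, G) ∞ f x)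
    {V W : Π y : M, TangentSpace I y} (hV : MDiffAt (T% V) x) (hW : MDiffAt (T% W) x)
    (ha : MDifferentiableAt I 𝓘(ℝ, G) a x) (hb : MDifferentiableAt I 𝓘(ℝ, G) b x)
    (hVa : ∀ᶠ y in 𝓝 x, mvfderiv I f y (V y) = a y)
    (hWb : ∀ᶠ y in 𝓝 x, mvfderiv I f y (W y) = b y) :
    mvfderiv I f x (mlieBracket I V W x) = mvfderiv I b x (V x) - mvfderiv I a x (W x) := by
  have htarget := mem_extChartAt_target (I := I) x
  have hf' : ContDiffAt ℝ 2 (f ∘ (extChartAt I x).symm) (extChartAt I x x) := by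
    rw [← contMDiffAt_iff_contDiffAt]
    refine ContMDiffAt.of_le (n := ∞) (ContMDiffAt.comp _ (by rwa [extChartAt_to_inv])
      ((contMDiffOn_extChartAt_symm x).contMDiffAt (extChartAt_target_mem_nhds x)))
      (WithTop.coe_le_coe.2 le_top)
  have hbracket := fderiv_lieBracket hf' (differentiableAt_chartField hV)
    (differentiableAt_chartField hW)
  rw [← chartField_mlieBracket hV hW,
    fderiv_comp_extChartAt_symm_chartField htarget
      (by rw [extChartAt_to_inv]; exact hf.mdifferentiableAt (by simp)), extChartAt_to_inv,
    fderiv_fderiv_comp_extChartAt_symm_chartField hf hb hWb,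
    fderiv_fderiv_comp_extChartAt_symm_chartField hf ha hVa] at hbracket
  exact hbracket

end Commutator

section Coordinates

variable {E : Type*} [NormedAddCommGroup E] [NormedSpace ℝ E]
  {H : Type*} [TopologicalSpace H] {I : ModelWithCorners ℝ E H}
  {M : Type*} [TopologicalSpace M] [ChartedSpace H M]
  {F : Type*} [NormedAddCommGroup F] [NormedSpace ℝ F]
  {A : M → Type*} [TopologicalSpace (TotalSpace F A)]
  [∀ x, TopologicalSpace (A x)] [∀ x, AddCommGroup (A x)] [∀ x, Module ℝ (A x)]
  [FiberBundle F A] [VectorBundle ℝ F A]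
  {F' : Type*} [NormedAddCommGroup F'] [NormedSpace ℝ F']
  {A' : M → Type*} [TopologicalSpace (TotalSpace F' A')]
  [∀ x, TopologicalSpace (A' x)] [∀ x, AddCommGroup (A' x)] [∀ x, Module ℝ (A' x)]
  [FiberBundle F' A'] [VectorBundle ℝ F' A']

variable (F F') in
/-- The matrix of a bundle map in the local frames at `p`. -/
def homCoord (p : M) (φ : ∀ x, A x →L[ℝ] A' x) (x : M) : F →L[ℝ] F' :=
  coframe F' A' p x ∘L φ x ∘L frame F A p x

theorem homCoord_coframe {p x : M} (hx : x ∈ (trivializationAt F A p).baseSet)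
    (φ : ∀ x, A x →L[ℝ] A' x) (a : A x) :
    homCoord F F' p φ x (coframe F A p x a) = coframe F' A' p x (φ x a) :=
  congrArg (fun b => coframe F' A' p x (φ x b)) (frame_coframe hx a)

theorem frame_homCoord {p x : M} (hx : x ∈ (trivializationAt F' A' p).baseSet)
    (φ : ∀ x, A x →L[ℝ] A' x) (u : F) :
    frame F' A' p x (homCoord F F' p φ x u) = φ x (frame F A p x u) :=
  frame_coframe hx _

variable (F) in
/-- The Gram matrix of a field of bilinear forms in the local frame at `p`. -/
def bilinCoord (p : M) (B : ∀ x, A x →L[ℝ] A x →L[ℝ] ℝ) (x : M) : F →L[ℝ] F →L[ℝ] ℝ :=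
  (frame F A p x).precomp ℝ ∘L B x ∘L frame F A p x

theorem bilinCoord_apply (p : M) (B : ∀ x, A x →L[ℝ] A x →L[ℝ] ℝ) (x : M) (u v : F) :
    bilinCoord F p B x u v = B x (frame F A p x u) (frame F A p x v) := rfl

theorem contMDiffAt_homCoord_iff [∀ x, IsTopologicalAddGroup (A' x)]
    [∀ x, ContinuousSMul ℝ (A' x)] {n : ℕ∞ω} {p : M} {φ : ∀ x, A x →L[ℝ] A' x} :
    ContMDiffAt I 𝓘(ℝ, F →L[ℝ] F') n (homCoord F F' p φ) p ↔
      ContMDiffAt I (I.prod 𝓘(ℝ, F →L[ℝ] F')) n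
        (fun x => TotalSpace.mk' (F →L[ℝ] F') (E := fun x : M => A x →L[ℝ] A' x) x (φ x)) p := by
  rw [contMDiffAt_hom_bundle]
  exact ⟨fun h => ⟨contMDiffAt_id, h⟩, And.right⟩

theorem contMDiffAt_bilinCoord_iff {n : ℕ∞ω} {p : M} {B : ∀ x, A x →L[ℝ] A x →L[ℝ] ℝ} :
    ContMDiffAt I 𝓘(ℝ, F →L[ℝ] F →L[ℝ] ℝ) n (bilinCoord F p B) p ↔
      ContMDiffAt I (I.prod 𝓘(ℝ, F →L[ℝ] F →L[ℝ] ℝ)) n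
        (fun x => TotalSpace.mk' (F →L[ℝ] F →L[ℝ] ℝ) (E := fun x : M => A x →L[ℝ] A x →L[ℝ] ℝ)
          x (B x)) p := by
  have heq : (fun x => ContinuousLinearMap.inCoordinates F A (F →L[ℝ] ℝ)
      (fun x => A x →L[ℝ] ℝ) p x p x (B x)) =ᶠ[𝓝 p] bilinCoord F p B := by
    filter_upwards [eventually_mem_baseSet (F := F) (A := A) p] with x hx
    ext u v
    exact inCoordinates_bilin_apply hx (B x) u v
  rw [contMDiffAt_hom_bundle]
  exact ⟨fun h => ⟨contMDiffAt_id, h.congr_of_eventuallyEq heq⟩,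
    fun h => h.2.congr_of_eventuallyEq heq.symm⟩

end Coordinates

section LeftInverse

variable {E : Type*} [NormedAddCommGroup E] [NormedSpace ℝ E]
  {H : Type*} [TopologicalSpace H] {I : ModelWithCorners ℝ E H}
  {M : Type*} [TopologicalSpace M] [ChartedSpace H M]
  {F : Type*} [NormedAddCommGroup F] [NormedSpace ℝ F]
  {G : Type*} [NormedAddCommGroup G] [NormedSpace ℝ G] {n : ℕ∞ω}

theorem exists_contMDiffAt_left_inverse [FiniteDimensional ℝ F] {D : M → G →L[ℝ] F} {x : M}
    (hD : ContMDiffAt I 𝓘(ℝ, G →L[ℝ] F) n D x) (hinj : Function.Injective (D x)) :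
    ∃ L : M → F →L[ℝ] G, ContMDiffAt I 𝓘(ℝ, F →L[ℝ] G) n L x ∧
      ∀ᶠ y in 𝓝 x, ∀ u, L y (D y u) = u := by
  have : FiniteDimensional ℝ G := .of_injective (D x : G →ₗ[ℝ] F) hinj
  have : CompleteSpace G := FiniteDimensional.complete ℝ G
  obtain ⟨P, hP⟩ := ContinuousLinearMap.HasLeftInverse.of_injective_of_finiteDimensional hinj
  have hPD : ContMDiffAt I 𝓘(ℝ, G →L[ℝ] G) n (fun y => P ∘L D y) x :=
    contMDiffAt_const.clm_comp hD
  have hone : P ∘L D x = ((1 : (G →L[ℝ] G)ˣ) : G →L[ℝ] G) := ContinuousLinearMap.ext hP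
  refine ⟨fun y => Ring.inverse (P ∘L D y) ∘L P, ?_, ?_⟩
  · exact (ContDiffAt.comp_contMDiffAt (g := Ring.inverse)
      (hone ▸ contDiffAt_ringInverse ℝ 1) hPD).clm_comp contMDiffAt_const
  · filter_upwards [hPD.continuousAt.eventually (hone ▸ Units.nhds 1)] with y hy u
    exact DFunLike.congr_fun (Ring.inverse_mul_cancel _ hy) u

end LeftInverse

section ConstantRank

variable {E : Type*} [NormedAddCommGroup E] [NormedSpace ℝ E]
  {H : Type*} [TopologicalSpace H] {I : ModelWithCorners ℝ E H}
  {M : Type*} [TopologicalSpace M] [ChartedSpace H M]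
  {F : Type*} [NormedAddCommGroup F] [NormedSpace ℝ F]
  {G : Type*} [NormedAddCommGroup G] [NormedSpace ℝ G]
  {R : M → F →L[ℝ] G} {p : M} {B : M → E →L[ℝ] G →L[ℝ] G} {C : M → E →L[ℝ] F →L[ℝ] F}

theorem mdifferentiableAt_comp_kerExtension [CompleteSpace F] {Q : G →L[ℝ] F} {R₀ : F →L[ℝ] G}
    {x : M} (hR : MDifferentiableAt I 𝓘(ℝ, F →L[ℝ] G) R x)
    (hunit : IsUnit (1 + Q ∘L (R x - R₀))) :
    MDifferentiableAt I 𝓘(ℝ, F →L[ℝ] G) (fun y => R y ∘L kerExtension Q R₀ (R y)) x :=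
  ((hasFDerivAt_comp_kerExtension hunit).hasMFDerivAt.comp x hR.hasMFDerivAt).mdifferentiableAt

theorem mvfderiv_comp_kerExtension [CompleteSpace F] {Q : G →L[ℝ] F} {R₀ : F →L[ℝ] G}
    {x : M} (hR : MDifferentiableAt I 𝓘(ℝ, F →L[ℝ] G) R x)
    (hunit : IsUnit (1 + Q ∘L (R x - R₀))) (v : TangentSpace I x) :
    mvfderiv I (fun y => R y ∘L kerExtension Q R₀ (R y)) x v =
      (1 - R x ∘L Ring.inverse (1 + Q ∘L (R x - R₀)) ∘L Q) ∘L mvfderiv I R x v ∘L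
        kerExtension Q R₀ (R x) :=
  DFunLike.congr_fun
    ((hasFDerivAt_comp_kerExtension hunit).hasMFDerivAt.comp x hR.hasMFDerivAt).mfderiv v

variable [I.Boundaryless] [IsManifold I ∞ M]

theorem eventually_eq_zero_of_mvfderiv_eq (h₀ : R p = 0)
    (hR : ∀ᶠ x in 𝓝 p, MDifferentiableAt I 𝓘(ℝ, F →L[ℝ] G) R x)
    (hB : ContinuousAt B p) (hC : ContinuousAt C p)
    (hd : ∀ᶠ x in 𝓝 p, ∀ u, mvfderiv I R x (frame E (TangentSpace I) p x u) =
      B x u ∘L R x + R x ∘L C x u) : ∀ᶠ x in 𝓝 p, R x = 0 := by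
  let _ : SeminormedAddGroup (E →L[ℝ] G →L[ℝ] G) := SeminormedAddCommGroup.toSeminormedAddGroup
  let _ : SeminormedAddGroup (E →L[ℝ] F →L[ℝ] F) := SeminormedAddCommGroup.toSeminormedAddGroup
  have hbound : ∀ᶠ x in 𝓝 p, ‖B x‖ + ‖C x‖ < ‖B p‖ + ‖C p‖ + 1 :=
    (hB.norm.add hC.norm).eventually_lt_const (lt_add_one _)
  refine eventually_eq_zero_of_norm_mvfderiv_le (I := I) (K := ‖B p‖ + ‖C p‖ + 1) h₀ hR ?_
  filter_upwards [hd, hbound] with x hx hxK u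
  rw [hx u]
  calc ‖B x u ∘L R x + R x ∘L C x u‖ ≤ ‖B x‖ * ‖u‖ * ‖R x‖ + ‖R x‖ * (‖C x‖ * ‖u‖) := by
        refine norm_add_le_of_le ?_ ?_ <;>
        · refine (ContinuousLinearMap.opNorm_comp_le _ _).trans ?_
          gcongr
          exact ContinuousLinearMap.le_opNorm _ _
    _ = (‖B x‖ + ‖C x‖) * ‖u‖ * ‖R x‖ := by ring
    _ ≤ (‖B p‖ + ‖C p‖ + 1) * ‖u‖ * ‖R x‖ := by gcongr

theorem eventually_comp_kerExtension_eq_zero [CompleteSpace F] {Q : G →L[ℝ] F}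
    (hQ : R p ∘L Q ∘L R p = R p) (hR : ContMDiffAt I 𝓘(ℝ, F →L[ℝ] G) ∞ R p)
    (hB : ContinuousAt B p) (hC : ContinuousAt C p)
    (hd : ∀ᶠ x in 𝓝 p, ∀ u, mvfderiv I R x (frame E (TangentSpace I) p x u) =
      B x u ∘L R x + R x ∘L C x u) :
    ∀ᶠ x in 𝓝 p, R x ∘L kerExtension Q (R p) (R x) = 0 := by
  have hp : IsUnit (1 + Q ∘L (R p - R p)) := by simp
  have hunit : ∀ᶠ x in 𝓝 p, IsUnit (1 + Q ∘L (R x - R p)) :=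
    hR.continuousAt.eventually (eventually_isUnit_one_add_comp_sub Q (R p))
  have hRd := eventually_mdifferentiableAt_of_contMDiffAt hR
  set V := fun x => kerExtension Q (R p) (R x)
  set U := fun x => 1 - R x ∘L Ring.inverse (1 + Q ∘L (R x - R p)) ∘L Q
  have hV : ContinuousAt V p :=
    ((contDiffAt_kerExtension (n := 0) hp).continuousAt).comp hR.continuousAt
  have hU : ContinuousAt U p := by
    have hinv := ((contDiffAt_ringInverse_one_add_comp_sub (n := 0) hp).continuousAt).comp
      hR.continuousAt
    exact continuousAt_const.sub (hR.continuousAt.clm_comp (hinv.clm_comp continuousAt_const))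
  refine eventually_eq_zero_of_mvfderiv_eq (I := I) (R := fun x => R x ∘L V x)
    (B := fun x => ContinuousLinearMap.compL ℝ G G G (U x) ∘L B x)
    (C := fun x => (ContinuousLinearMap.compL ℝ F F F).flip (V x) ∘L C x) ?_ ?_
    (((ContinuousLinearMap.continuous _).continuousAt.comp hU).clm_comp hB)
    (((ContinuousLinearMap.continuous _).continuousAt.comp hV).clm_comp hC) ?_
  · change R p ∘L kerExtension Q (R p) (R p) = 0
    rw [kerExtension_self, ContinuousLinearMap.comp_sub, hQ]
    exact sub_self (R p)
  · filter_upwards [hunit, hRd] with x hx hRx using mdifferentiableAt_comp_kerExtension hRx hx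
  · filter_upwards [hunit, hRd, hd] with x hx hRx hdx u
    rw [mvfderiv_comp_kerExtension hRx hx, hdx u, ContinuousLinearMap.add_comp,
      ContinuousLinearMap.comp_add]
    exact congrArg (fun W => U x ∘L B x u ∘L R x ∘L V x + W ∘L C x u ∘L V x)
      (comp_kerExtension hx).symm

theorem exists_contMDiffAt_ker_extension [FiniteDimensional ℝ F] [FiniteDimensional ℝ G]
    (hR : ContMDiffAt I 𝓘(ℝ, F →L[ℝ] G) ∞ R p) (hB : ContinuousAt B p) (hC : ContinuousAt C p)
    (hd : ∀ᶠ x in 𝓝 p, ∀ u, mvfderiv I R x (frame E (TangentSpace I) p x u) =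
      B x u ∘L R x + R x ∘L C x u) :
    ∃ V : M → F →L[ℝ] F, ContMDiffAt I 𝓘(ℝ, F →L[ℝ] F) ∞ V p ∧ (∀ v, R p v = 0 → V p v = v) ∧
      ∀ᶠ x in 𝓝 p, R x ∘L V x = 0 := by
  have : CompleteSpace F := FiniteDimensional.complete ℝ F
  obtain ⟨Q, hQ⟩ := exists_comp_comp_eq_self (R p : F →ₗ[ℝ] G)
  set Q' : G →L[ℝ] F := LinearMap.toContinuousLinearMap Q
  have hQ' : R p ∘L Q' ∘L R p = R p := ContinuousLinearMap.coe_injective hQ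
  refine ⟨fun x => kerExtension Q' (R p) (R x),
    (contDiffAt_kerExtension (by simp)).comp_contMDiffAt hR, fun v hv => ?_,
    eventually_comp_kerExtension_eq_zero hQ' hR hB hC hd⟩
  change kerExtension Q' (R p) (R p) v = v
  rw [kerExtension_self]
  change v - Q' (R p v) = v
  rw [hv, map_zero, sub_zero]

end ConstantRank

theorem continuousAt_constrL {κ : Type*} [Finite κ] {F : Type*} [NormedAddCommGroup F]
    [NormedSpace ℝ F] [FiniteDimensional ℝ F] {G : Type*} [NormedAddCommGroup G]
    [NormedSpace ℝ G] {X : Type*} [TopologicalSpace X] (b : Module.Basis κ ℝ F) {f : κ → X → G}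
    {x : X} (hf : ∀ k, ContinuousAt (f k) x) :
    ContinuousAt (fun y => (b.constrL fun k => f k y : F →L[ℝ] G)) x := by
  have := Fintype.ofFinite κ
  refine continuousAt_clm_apply.2 fun u => ?_
  simp only [Module.Basis.constrL_apply]
  exact tendsto_finsetSum _ fun k _ => (hf k).const_smul _

namespace LieAlgebroid

section Anchor

variable {E : Type*} [NormedAddCommGroup E] [NormedSpace ℝ E]
  {H : Type*} [TopologicalSpace H] {I : ModelWithCorners ℝ E H}
  {M : Type*} [TopologicalSpace M] [ChartedSpace H M] [IsManifold I ∞ M]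
  {F : Type*} [NormedAddCommGroup F] [NormedSpace ℝ F]
  {A : M → Type*} [TopologicalSpace (TotalSpace F A)]
  [∀ x, TopologicalSpace (A x)] [∀ x, AddCommGroup (A x)] [∀ x, Module ℝ (A x)]
  [FiberBundle F A] [VectorBundle ℝ F A]
  (𝒜 : LieAlgebroid I F A)

theorem contMDiffAt_homCoord_anchor (p : M) :
    ContMDiffAt I 𝓘(ℝ, F →L[ℝ] E) ∞ (homCoord F E p 𝒜.anchor) p :=
  contMDiffAt_homCoord_iff.2 (𝒜.contMDiff_anchor p)

theorem contMDiff_anchor_section (s : Cₛ^∞⟮I; F, A⟯) :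
    ContMDiff I I.tangent ∞ (fun x => (⟨x, 𝒜.anchor x (s x)⟩ : TangentBundle I M)) :=
  𝒜.contMDiff_anchor.clm_bundle_apply s.contMDiff

theorem mdifferentiableAt_anchor_section (s : Cₛ^∞⟮I; F, A⟯) (x : M) :
    MDiffAt (T% fun y => 𝒜.anchor y (s y)) x :=
  (𝒜.contMDiff_anchor_section s x).mdifferentiableAt (by simp)

variable [I.Boundaryless] [CompleteSpace E]

theorem eventually_mvfderiv_homCoord_anchor_apply {s t : Cₛ^∞⟮I; F, A⟯} {p : M} {u : F}
    (ht : ∀ᶠ x in 𝓝 p, t x = frame F A p x u) :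
    ∀ᶠ x in 𝓝 p, mvfderiv I (homCoord F E p 𝒜.anchor) x (𝒜.anchor x (s x)) u =
      mvfderiv I (fun y => coframe E (TangentSpace I) p y (𝒜.anchor y (s y))) x
          (frame E (TangentSpace I) p x (homCoord F E p 𝒜.anchor x u)) +
        homCoord F E p 𝒜.anchor x (coframe F A p x (𝒜.bracket s t x)) := by
  have hX : ContMDiffAt I 𝓘(ℝ, E) ∞
      (fun y => coframe E (TangentSpace I) p y (𝒜.anchor y (s y))) p :=
    contMDiffAt_section_iff_coframe.1 (𝒜.contMDiff_anchor_section s p)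
  filter_upwards [chart_source_mem_nhds H p, eventually_mem_baseSet (F := F) (A := A) p,
    ht.eventually_nhds, eventually_mdifferentiableAt_of_contMDiffAt hX,
    eventually_mdifferentiableAt_of_contMDiffAt (𝒜.contMDiffAt_homCoord_anchor p)]
    with x hx hbase htx hXx hRx
  have hsource : ∀ᶠ y in 𝓝 x, y ∈ (chartAt H p).source := (chartAt H p).open_source.mem_nhds hx
  have happly : MDifferentiableAt I 𝓘(ℝ, E) (fun y => homCoord F E p 𝒜.anchor y u) x :=
    hRx.clm_apply mdifferentiableAt_const
  have hbracket := mvfderiv_mlieBracket (f := extChartAt I p) (contMDiffAt_extChartAt' hx)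
    (𝒜.mdifferentiableAt_anchor_section s x) (𝒜.mdifferentiableAt_anchor_section t x) hXx happly
    (hsource.mono fun y hy => by rw [← coframe_tangent hy])
    (by
      filter_upwards [hsource, htx] with y hy hty
      rw [← coframe_tangent hy, hty]
      rfl)
  rw [← 𝒜.anchor_bracket, ← coframe_tangent hx, ← homCoord_coframe hbase] at hbracket
  rw [frame_homCoord (by simpa using hx), ← htx.self_of_nhds]
  exact (mvfderiv_clm_comp_apply (ContinuousLinearMap.apply ℝ E u) hRx _).symm.trans
    (sub_eq_iff_eq_add'.1 hbracket.symm)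

theorem exists_mvfderiv_homCoord_anchor [FiniteDimensional ℝ E] [T2Space M]
    [FiniteDimensional ℝ F] [ContMDiffVectorBundle ∞ F A I] (s : Cₛ^∞⟮I; F, A⟯) (p : M) :
    ∃ (B : M → E →L[ℝ] E) (C : M → F →L[ℝ] F), ContinuousAt B p ∧ ContinuousAt C p ∧
      ∀ᶠ x in 𝓝 p, mvfderiv I (homCoord F E p 𝒜.anchor) x (𝒜.anchor x (s x)) =
        B x ∘L homCoord F E p 𝒜.anchor x + homCoord F E p 𝒜.anchor x ∘L C x := by
  set b := Module.finBasis ℝ F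
  choose t ht using fun k => exists_section_eventuallyEq_frame I (A := A) p (b k)
  refine ⟨_, fun x => b.constrL fun k => coframe F A p x (𝒜.bracket s (t k) x),
    (contMDiffAt_mvfderiv_frame (contMDiffAt_section_iff_coframe.1
      (𝒜.contMDiff_anchor_section s p))).continuousAt, ?_, ?_⟩
  · exact continuousAt_constrL b fun k => (contMDiffAt_section_iff_coframe.1
      ((𝒜.bracket s (t k)).contMDiff p)).continuousAt
  · filter_upwards [eventually_all.2 fun k =>
      𝒜.eventually_mvfderiv_homCoord_anchor_apply (s := s) (ht k)] with x hx
    refine ContinuousLinearMap.coe_injective (b.ext fun k => (hx k).trans ?_)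
    simp only [ContinuousLinearMap.coe_coe, add_apply, ContinuousLinearMap.comp_apply,
      Module.Basis.constrL_basis]

end Anchor

end LieAlgebroid

namespace CompatibleTriple

section Hamiltonian

variable {E : Type*} [NormedAddCommGroup E] [NormedSpace ℝ E]
  {H : Type*} [TopologicalSpace H] {I : ModelWithCorners ℝ E H}
  {M : Type*} [TopologicalSpace M] [ChartedSpace H M] [IsManifold I ∞ M]
  {F : Type*} [NormedAddCommGroup F] [NormedSpace ℝ F]
  {A : M → Type*} [TopologicalSpace (TotalSpace F A)]
  [∀ x, TopologicalSpace (A x)] [∀ x, AddCommGroup (A x)] [∀ x, Module ℝ (A x)]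
  [∀ x, IsTopologicalAddGroup (A x)] [∀ x, ContinuousSMul ℝ (A x)]
  [FiberBundle F A] [VectorBundle ℝ F A]
  {𝒜 : LieAlgebroid I F A} (T : CompatibleTriple 𝒜)

theorem bilinCoord_form_injective (p : M) :
    Function.Injective (bilinCoord F p T.form.toFun p) := by
  have hp := FiberBundle.mem_baseSet_trivializationAt F A p
  refine (injective_iff_map_eq_zero _).2 fun u hu => ?_
  rw [← coframe_frame hp u, T.isSymplectic.nondegenerate p (frame F A p p u), map_zero]
  intro w
  rw [← frame_coframe hp w, ← bilinCoord_apply, hu]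
  rfl

variable [FiniteDimensional ℝ F]

theorem exists_form_eq {p : M} (θ : A p →ₗ[ℝ] ℝ) : ∃ a : A p, ∀ b, T.form.toFun p a b = θ b := by
  have : FiniteDimensional ℝ (A p) := VectorBundle.finiteDimensional ℝ F A p
  set φ : A p →ₗ[ℝ] Module.Dual ℝ (A p) :=
    LinearMap.mk₂ ℝ (fun v w => T.form.toFun p v w) (by simp) (by simp) (by simp) (by simp)
  have hinj : Function.Injective φ := (injective_iff_map_eq_zero φ).2 fun v hv =>
    T.isSymplectic.nondegenerate p v fun w => LinearMap.congr_fun hv w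
  obtain ⟨a, ha⟩ := (LinearMap.injective_iff_surjective_of_finrank_eq_finrank
    Subspace.dual_finrank_eq.symm).1 hinj θ
  exact ⟨a, fun b => LinearMap.congr_fun ha b⟩

theorem exists_hamiltonian (f : C^∞⟮I, M; 𝓘(ℝ, ℝ), ℝ⟯) :
    ∃ s : Cₛ^∞⟮I; F, A⟯, ∀ x b, T.form.toFun x (s x) b = mvfderiv I f x (𝒜.anchor x b) := by
  choose s hs using fun x =>
    T.exists_form_eq ((mvfderiv I f x ∘L 𝒜.anchor x : A x →L[ℝ] ℝ) : A x →ₗ[ℝ] ℝ)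
  refine ⟨⟨s, fun p => contMDiffAt_section_iff_coframe.2 ?_⟩, hs⟩
  obtain ⟨K, hK, hKω⟩ := exists_contMDiffAt_left_inverse
    (contMDiffAt_bilinCoord_iff.2 (T.form.contMDiff p)) (T.bilinCoord_form_injective p)
  have hθ : ContMDiffAt I 𝓘(ℝ, F →L[ℝ] ℝ) ∞ (fun x =>
      (mvfderiv I f x ∘L frame E (TangentSpace I) p x) ∘L homCoord F E p 𝒜.anchor x) p :=
    (contMDiffAt_mvfderiv_frame (f.contMDiff p)).clm_comp (𝒜.contMDiffAt_homCoord_anchor p)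
  refine (hK.clm_apply hθ).congr_of_eventuallyEq ?_
  filter_upwards [hKω, eventually_mem_baseSet (F := F) (A := A) p, chart_source_mem_nhds H p]
    with x hx hbase hchart
  rw [← hx (coframe F A p x (s x))]
  congr 1
  ext v
  rw [bilinCoord_apply, frame_coframe hbase, hs]
  exact congrArg (mvfderiv I f x) (frame_homCoord (by simpa using hchart) 𝒜.anchor v).symm

theorem exists_section_mem_orth_L [FiniteDimensional ℝ E] [T2Space M] {p : M} {a : A p}
    (ha : a ∈ orth (T.form.toFun p) (T.L p)) :
    ∃ s : Cₛ^∞⟮I; F, A⟯, (∀ x, s x ∈ orth (T.form.toFun x) (T.L x)) ∧ s p = a := by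
  obtain ⟨ξ, hξ⟩ := T.exists_form_eq_comp_anchor ha
  obtain ⟨f, hf⟩ := exists_contMDiff_mvfderiv_eq (I := I) p
    (LinearMap.toContinuousLinearMap (ξ : E →ₗ[ℝ] ℝ) : E →L[ℝ] ℝ)
  obtain ⟨s, hs⟩ := T.exists_hamiltonian f
  refine ⟨s, fun x w hw => ?_, sub_eq_zero.1 (T.isSymplectic.nondegenerate p _ fun b => ?_)⟩
  · rw [hs, T.mem_L.1 hw, map_zero]
  · rw [map_sub, sub_apply, hs, hξ, hf]
    exact sub_self _

end Hamiltonian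

end CompatibleTriple

section Immersion

variable {E : Type*} [NormedAddCommGroup E] [NormedSpace ℝ E]
  {H : Type*} [TopologicalSpace H] {I : ModelWithCorners ℝ E H}
  {M : Type*} [TopologicalSpace M] [ChartedSpace H M]
  {E' : Type*} [NormedAddCommGroup E'] [NormedSpace ℝ E']
  {H' : Type*} [TopologicalSpace H'] {I' : ModelWithCorners ℝ E' H'}
  {O : Type*} [TopologicalSpace O] [ChartedSpace H' O]
  {ι : O → M}

variable (I') in
/-- An integral immersion of a generalized distribution `D`: an immersion, not necessarily
injective, whose tangent spaces are those of `D`. -/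
structure IsIntegralImmersion (D : ∀ p : M, Submodule ℝ (TangentSpace I p)) (ι : O → M) :
    Prop where
  contMDiff : ContMDiff I' I ∞ ι
  injective_mfderiv : ∀ q, Function.Injective (mfderiv I' I ι q)
  range_mfderiv : ∀ q, LinearMap.range
    (mfderiv I' I ι q : TangentSpace I' q →ₗ[ℝ] TangentSpace I (ι q)) = D (ι q)

theorem IsIntegralSubmanifold.isIntegralImmersion {D : ∀ p : M, Submodule ℝ (TangentSpace I p)}
    (hι : IsIntegralSubmanifold I' D ι) : IsIntegralImmersion I' D ι :=
  ⟨hι.contMDiff, hι.injective_mfderiv, hι.range_mfderiv⟩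

theorem IsIntegralImmersion.hasLeftInverse_mfderiv [FiniteDimensional ℝ E]
    {D : ∀ p : M, Submodule ℝ (TangentSpace I p)} (hι : IsIntegralImmersion I' D ι) (q : O) :
    (mfderiv I' I ι q).HasLeftInverse := by
  have : FiniteDimensional ℝ (TangentSpace I (ι q)) := inferInstanceAs (FiniteDimensional ℝ E)
  have : T2Space (TangentSpace I (ι q)) := inferInstanceAs (T2Space E)
  exact .of_injective_of_finiteDimensional (hι.injective_mfderiv q)

variable [IsManifold I ∞ M] [IsManifold I' ∞ O]

variable (I I' ι) in
/-- The matrix of the differential of `ι` in the local frames of the tangent bundles at `q₀` and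
at `ι q₀`. -/
def mfderivCoord (q₀ q : O) : E' →L[ℝ] E :=
  coframe E (TangentSpace I) (ι q₀) (ι q) ∘L mfderiv I' I ι q ∘L frame E' (TangentSpace I') q₀ q

theorem contMDiffAt_mfderivCoord {q₀ : O} (hι : ContMDiffAt I' I ∞ ι q₀) :
    ContMDiffAt I' 𝓘(ℝ, E' →L[ℝ] E) ∞ (mfderivCoord I I' ι q₀) q₀ :=
  hι.mfderiv_const (m := ∞) (by simp)

theorem mfderivCoord_coframe {q₀ q : O} (hq : q ∈ (chartAt H' q₀).source)
    (X : TangentSpace I' q) :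
    mfderivCoord I I' ι q₀ q (coframe E' (TangentSpace I') q₀ q X) =
      coframe E (TangentSpace I) (ι q₀) (ι q) (mfderiv I' I ι q X) :=
  congrArg (fun Y : TangentSpace I' q => coframe E (TangentSpace I) (ι q₀) (ι q)
    (mfderiv I' I ι q Y)) (frame_coframe (A := TangentSpace I') (by simpa using hq) X)

theorem mfderivCoord_injective {q : O} (hι : Function.Injective (mfderiv I' I ι q)) :
    Function.Injective (mfderivCoord I I' ι q q) := by
  have hframe : Function.Injective (frame E' (TangentSpace I' : O → Type _) q q) :=
    Function.LeftInverse.injective (coframe_frame (by simp))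
  exact (coframe_injective (by simp)).comp (hι.comp hframe)

variable {F : Type*} [NormedAddCommGroup F] [NormedSpace ℝ F]
  {A : M → Type*} [TopologicalSpace (TotalSpace F A)]
  [∀ x, TopologicalSpace (A x)] [∀ x, AddCommGroup (A x)] [∀ x, Module ℝ (A x)]
  [FiberBundle F A] [VectorBundle ℝ F A]

theorem LieAlgebroid.exists_coframe_eq_of_anchor_eq [FiniteDimensional ℝ E]
    (𝒜 : LieAlgebroid I F A) {q₀ : O} (hι : ContMDiffAt I' I ∞ ι q₀)
    (hinj : Function.Injective (mfderiv I' I ι q₀)) :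
    ∃ Ψ : O → F →L[ℝ] E', ContMDiffAt I' 𝓘(ℝ, F →L[ℝ] E') ∞ Ψ q₀ ∧ ∀ᶠ q in 𝓝 q₀,
      ∀ (X : TangentSpace I' q) (a : A (ι q)), 𝒜.anchor (ι q) a = mfderiv I' I ι q X →
        coframe E' (TangentSpace I') q₀ q X = Ψ q (coframe F A (ι q₀) (ι q) a) := by
  obtain ⟨K, hK, hKι⟩ := exists_contMDiffAt_left_inverse (contMDiffAt_mfderivCoord hι)
    (mfderivCoord_injective hinj)
  refine ⟨fun q => K q ∘L homCoord F E (ι q₀) 𝒜.anchor (ι q),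
    hK.clm_comp ((𝒜.contMDiffAt_homCoord_anchor (ι q₀)).comp q₀ hι), ?_⟩
  filter_upwards [hKι, chart_source_mem_nhds H' q₀,
    hι.continuousAt.eventually (eventually_mem_baseSet (F := F) (A := A) (ι q₀))]
    with q hKq hq hbase X a haX
  rw [ContinuousLinearMap.comp_apply, homCoord_coframe hbase, haX, ← mfderivCoord_coframe hq, hKq]

end Immersion

namespace CompatibleTriple

section IntegralImmersion

variable {E : Type*} [NormedAddCommGroup E] [NormedSpace ℝ E] [FiniteDimensional ℝ E]
  {H : Type*} [TopologicalSpace H] {I : ModelWithCorners ℝ E H}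
  {M : Type*} [TopologicalSpace M] [ChartedSpace H M] [IsManifold I ∞ M]
  {F : Type*} [NormedAddCommGroup F] [NormedSpace ℝ F] [FiniteDimensional ℝ F]
  {A : M → Type*} [TopologicalSpace (TotalSpace F A)]
  [∀ x, TopologicalSpace (A x)] [∀ x, AddCommGroup (A x)] [∀ x, Module ℝ (A x)]
  [∀ x, IsTopologicalAddGroup (A x)] [∀ x, ContinuousSMul ℝ (A x)]
  [FiberBundle F A] [VectorBundle ℝ F A]
  {𝒜 : LieAlgebroid I F A}
  {E' : Type*} [NormedAddCommGroup E'] [NormedSpace ℝ E']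
  {H' : Type*} [TopologicalSpace H'] {I' : ModelWithCorners ℝ E' H'}
  {O : Type*} [TopologicalSpace O] [ChartedSpace H' O] [IsManifold I' ∞ O]
  (T : CompatibleTriple 𝒜) {ι : O → M}

theorem exists_field_mfderiv_eq (hι : IsIntegralImmersion I' T.Λ ι) {s : Cₛ^∞⟮I; F, A⟯}
    (hs : ∀ x, s x ∈ orth (T.form.toFun x) (T.L x)) :
    ∃ Y : Cₛ^∞⟮I'; E', (TangentSpace I' : O → Type _)⟯,
      ∀ q, mfderiv I' I ι q (Y q) = 𝒜.anchor (ι q) (s (ι q)) := by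
  have hΛ : ∀ q, ∃ X : TangentSpace I' q, mfderiv I' I ι q X = 𝒜.anchor (ι q) (s (ι q)) :=
    fun q => ((hι.range_mfderiv q).ge (T.mem_Λ.2 ⟨_, hs (ι q), rfl⟩) :)
  choose Y hY using hΛ
  refine ⟨⟨Y, fun q₀ => contMDiffAt_section_iff_coframe.2 ?_⟩, hY⟩
  obtain ⟨Ψ, hΨ, hΨY⟩ := 𝒜.exists_coframe_eq_of_anchor_eq (hι.contMDiff q₀)
    (hι.injective_mfderiv q₀)
  have hcoord := (contMDiffAt_section_iff_coframe.1 (s.contMDiff (ι q₀))).comp q₀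
    (hι.contMDiff q₀)
  exact (hΨ.clm_apply hcoord).congr_of_eventuallyEq
    (hΨY.mono fun q hq => hq (Y q) _ (hY q).symm)

variable [T2Space M]

theorem exists_related_section (hι : IsIntegralImmersion I' T.Λ ι) {q : O}
    (X : TangentSpace I' q) :
    ∃ (s : Cₛ^∞⟮I; F, A⟯) (Y : Cₛ^∞⟮I'; E', (TangentSpace I' : O → Type _)⟯),
      (∀ x, s x ∈ orth (T.form.toFun x) (T.L x)) ∧
        (∀ q, mfderiv I' I ι q (Y q) = 𝒜.anchor (ι q) (s (ι q))) ∧ Y q = X := by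
  obtain ⟨a, ha, haX⟩ := T.mem_Λ.1 ((hι.range_mfderiv q).le ⟨X, rfl⟩)
  obtain ⟨s, hs, rfl⟩ := T.exists_section_mem_orth_L ha
  obtain ⟨Y, hY⟩ := T.exists_field_mfderiv_eq hι hs
  exact ⟨s, Y, hs, hY, hι.injective_mfderiv q ((hY q).trans haX)⟩

variable [FiniteDimensional ℝ E']

theorem exists_eventually_sum_related_eq_frame (hι : IsIntegralImmersion I' T.Λ ι) (q₀ : O) :
    ∃ (s : Fin (Module.finrank ℝ E') → Cₛ^∞⟮I; F, A⟯) (N : O → E' →L[ℝ] E'),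
      ContinuousAt N q₀ ∧ ∀ᶠ q in 𝓝 q₀, ∀ u,
        mfderiv I' I ι q (frame E' (TangentSpace I') q₀ q u) =
          ∑ i, (Module.finBasis ℝ E').repr (N q u) i • 𝒜.anchor (ι q) (s i (ι q)) := by
  set b := Module.finBasis ℝ E'
  choose s Y _ hY hYq₀ using fun i =>
    T.exists_related_section hι (frame E' (TangentSpace I') q₀ q₀ (b i))
  set D : O → E' →L[ℝ] E' :=
    fun q => b.constrL fun i => coframe E' (TangentSpace I') q₀ q (Y i q)
  have hD : ContinuousAt D q₀ := continuousAt_constrL b fun i =>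
    (contMDiffAt_section_iff_coframe.1 ((Y i).contMDiff q₀)).continuousAt
  have hDq₀ : D q₀ = ((1 : (E' →L[ℝ] E')ˣ) : E' →L[ℝ] E') := by
    refine ContinuousLinearMap.coe_injective (b.ext fun i => ?_)
    simp only [D, ContinuousLinearMap.coe_coe, Module.Basis.constrL_basis, hYq₀]
    exact coframe_frame (by simp) (b i)
  have : CompleteSpace E' := FiniteDimensional.complete ℝ E'
  refine ⟨s, fun q => Ring.inverse (D q),
    ContinuousAt.comp (g := Ring.inverse) (hDq₀ ▸ NormedRing.inverse_continuousAt 1) hD, ?_⟩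
  filter_upwards [hD.eventually (hDq₀ ▸ Units.nhds 1), chart_source_mem_nhds H' q₀] with q hDq hq u
  have hu : D q (Ring.inverse (D q) u) = u := DFunLike.congr_fun (Ring.mul_inverse_cancel _ hDq) u
  conv_lhs => rw [← hu]
  simp only [D, Module.Basis.constrL_apply, Module.Basis.equivFun_apply, map_sum, map_smul, ← hY]
  refine Finset.sum_congr rfl fun i _ => ?_
  rw [frame_coframe (by simpa using hq)]

theorem exists_mvfderiv_homCoord_anchor_comp [I.Boundaryless] [ContMDiffVectorBundle ∞ F A I]
    (hι : IsIntegralImmersion I' T.Λ ι) (q₀ : O) :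
    ∃ (B : O → E' →L[ℝ] E →L[ℝ] E) (C : O → E' →L[ℝ] F →L[ℝ] F),
      ContinuousAt B q₀ ∧ ContinuousAt C q₀ ∧ ∀ᶠ q in 𝓝 q₀, ∀ u,
        mvfderiv I' (fun q => homCoord F E (ι q₀) 𝒜.anchor (ι q)) q
            (frame E' (TangentSpace I') q₀ q u) =
          B q u ∘L homCoord F E (ι q₀) 𝒜.anchor (ι q) +
            homCoord F E (ι q₀) 𝒜.anchor (ι q) ∘L C q u := by
  obtain ⟨s, N, hN, hNs⟩ := T.exists_eventually_sum_related_eq_frame hι q₀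
  have : CompleteSpace E := FiniteDimensional.complete ℝ E
  choose B C hB hC hBC using fun i => 𝒜.exists_mvfderiv_homCoord_anchor (s i) (ι q₀)
  have hιc := (hι.contMDiff q₀).continuousAt
  set b := Module.finBasis ℝ E'
  refine ⟨fun q => (b.constrL fun i => B i (ι q)) ∘L N q,
    fun q => (b.constrL fun i => C i (ι q)) ∘L N q,
    (continuousAt_constrL b fun i => (hB i).comp hιc).clm_comp hN,
    (continuousAt_constrL b fun i => (hC i).comp hιc).clm_comp hN, ?_⟩
  filter_upwards [hNs, hιc.eventually (eventually_all.2 hBC),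
    hιc.eventually (eventually_mdifferentiableAt_of_contMDiffAt
      (𝒜.contMDiffAt_homCoord_anchor (ι q₀)))] with q hNq hBCq hRq u
  refine (mfderiv_comp_apply q hRq (hι.contMDiff.mdifferentiable (by simp) q) _).trans ?_
  rw [hNq]
  change mvfderiv I (homCoord F E (ι q₀) 𝒜.anchor) (ι q) _ = _
  simp only [map_sum, map_smul, hBCq, ContinuousLinearMap.comp_apply, Module.Basis.constrL_apply,
    Module.Basis.equivFun_apply, smul_add, Finset.sum_add_distrib]
  ext w
  simp only [sum_apply, smul_apply, add_apply, ContinuousLinearMap.comp_apply, map_sum, map_smul]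

theorem exists_anchor_ker_extension [I.Boundaryless] [I'.Boundaryless]
    [ContMDiffVectorBundle ∞ F A I] (hι : IsIntegralImmersion I' T.Λ ι) (q₀ : O) :
    ∃ V : O → F →L[ℝ] F, ContMDiffAt I' 𝓘(ℝ, F →L[ℝ] F) ∞ V q₀ ∧
      (∀ l ∈ T.L (ι q₀), V q₀ (coframe F A (ι q₀) (ι q₀) l) = coframe F A (ι q₀) (ι q₀) l) ∧
      ∀ᶠ q in 𝓝 q₀, ∀ u, frame F A (ι q₀) (ι q) (V q u) ∈ T.L (ι q) := by
  obtain ⟨B, C, hB, hC, hBC⟩ := T.exists_mvfderiv_homCoord_anchor_comp hι q₀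
  obtain ⟨V, hV, hVL, hRV⟩ := exists_contMDiffAt_ker_extension
    ((𝒜.contMDiffAt_homCoord_anchor (ι q₀)).comp q₀ (hι.contMDiff q₀)) hB hC hBC
  refine ⟨V, hV, fun l hl => hVL _ ?_, ?_⟩
  · change homCoord F E (ι q₀) 𝒜.anchor (ι q₀) _ = 0
    rw [homCoord_coframe (FiberBundle.mem_baseSet_trivializationAt F A _), T.mem_L.1 hl, map_zero]
  · filter_upwards [hRV, (hι.contMDiff q₀).continuousAt.eventually
      (eventually_mem_baseSet (F := E) (A := TangentSpace I) (ι q₀))] with q hRVq hq u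
    rw [T.mem_L, ← frame_homCoord hq, ← map_zero (frame E (TangentSpace I) _ _)]
    exact congrArg _ (DFunLike.congr_fun hRVq u)

end IntegralImmersion

end CompatibleTriple

section Bilinear

variable {E : Type*} [NormedAddCommGroup E] [NormedSpace ℝ E]
  {H : Type*} [TopologicalSpace H] {I : ModelWithCorners ℝ E H}
  {M : Type*} [TopologicalSpace M] [ChartedSpace H M]
  {F : Type*} [NormedAddCommGroup F] [NormedSpace ℝ F]
  {G : Type*} [NormedAddCommGroup G] [NormedSpace ℝ G]
  {G' : Type*} [NormedAddCommGroup G'] [NormedSpace ℝ G'] {n : ℕ∞ω}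

theorem contMDiffAt_bilinearComp {B : M → F →L[ℝ] F →L[ℝ] ℝ} {S : M → G →L[ℝ] F}
    {S' : M → G' →L[ℝ] F} {x : M} (hB : ContMDiffAt I 𝓘(ℝ, F →L[ℝ] F →L[ℝ] ℝ) n B x)
    (hS : ContMDiffAt I 𝓘(ℝ, G →L[ℝ] F) n S x) (hS' : ContMDiffAt I 𝓘(ℝ, G' →L[ℝ] F) n S' x) :
    ContMDiffAt I 𝓘(ℝ, G →L[ℝ] G' →L[ℝ] ℝ) n (fun y => (B y).bilinearComp (S y) (S' y)) x := by
  let _ : NormedAddCommGroup ((F →L[ℝ] ℝ) →L[ℝ] G' →L[ℝ] ℝ) :=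
    ContinuousLinearMap.toNormedAddCommGroup
  have hprecomp : ContDiff ℝ n fun L : G' →L[ℝ] F => L.precomp ℝ :=
    (ContinuousLinearMap.compL ℝ G' F ℝ).flip.contDiff
  exact (hprecomp.contDiffAt.comp_contMDiffAt hS').clm_comp (hB.clm_comp hS)

/- The solution of `R y u = w`, `G y u (V y ·) = 0` depends smoothly on `y` because this linear
system for `u` is injective at `x`. -/
theorem exists_contMDiffAt_orthogonal_lift [FiniteDimensional ℝ F] [FiniteDimensional ℝ G]
    {R : M → F →L[ℝ] G} {B : M → F →L[ℝ] F →L[ℝ] ℝ} {V : M → F →L[ℝ] F} {x : M}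
    (hR : ContMDiffAt I 𝓘(ℝ, F →L[ℝ] G) n R x)
    (hB : ContMDiffAt I 𝓘(ℝ, F →L[ℝ] F →L[ℝ] ℝ) n B x)
    (hV : ContMDiffAt I 𝓘(ℝ, F →L[ℝ] F) n V x) (hdef : ∀ u, B x u u = 0 → u = 0)
    (hVR : ∀ u, R x u = 0 → V x u = u) :
    ∃ K : M → G →L[ℝ] F, ContMDiffAt I 𝓘(ℝ, G →L[ℝ] F) n K x ∧
      ∀ᶠ y in 𝓝 x, ∀ u, (∀ w, B y u (V y w) = 0) → K y (R y u) = u := by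
  set inl := ContinuousLinearMap.inl ℝ G (F →L[ℝ] ℝ)
  set inr := ContinuousLinearMap.inr ℝ G (F →L[ℝ] ℝ)
  set BV : M → F →L[ℝ] F →L[ℝ] ℝ := fun y => (B y).bilinearComp (.id ℝ F) (V y)
  have hsys : ContMDiffAt I 𝓘(ℝ, F →L[ℝ] G × (F →L[ℝ] ℝ)) n
      (fun y => inl ∘L R y + inr ∘L BV y) x :=
    (contMDiffAt_const.clm_comp hR).add
      (contMDiffAt_const.clm_comp (contMDiffAt_bilinearComp hB contMDiffAt_const hV))
  have hinj : Function.Injective (inl ∘L R x + inr ∘L BV x) := by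
    refine (injective_iff_map_eq_zero _).2 fun u hu => hdef u ?_
    have hRu : R x u = 0 := by simpa [inl, inr] using congrArg Prod.fst hu
    have hBu : BV x u = 0 := by simpa [inl, inr] using congrArg Prod.snd hu
    simpa [BV, hVR u hRu] using DFunLike.congr_fun hBu u
  obtain ⟨K, hK, hKsys⟩ := exists_contMDiffAt_left_inverse hsys hinj
  refine ⟨fun y => K y ∘L inl, hK.clm_comp contMDiffAt_const, hKsys.mono fun y hy u hu => ?_⟩
  have hBu : BV y u = 0 := ContinuousLinearMap.ext hu
  simpa [hBu] using hy u

end Bilinear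

section Pullback

variable {E : Type*} [NormedAddCommGroup E] [NormedSpace ℝ E]
  {H : Type*} [TopologicalSpace H] {I : ModelWithCorners ℝ E H}
  {M : Type*} [TopologicalSpace M] [ChartedSpace H M]
  {F : Type*} [NormedAddCommGroup F] [NormedSpace ℝ F]
  {A : M → Type*} [TopologicalSpace (TotalSpace F A)]
  [∀ x, TopologicalSpace (A x)] [∀ x, AddCommGroup (A x)] [∀ x, Module ℝ (A x)]
  [FiberBundle F A] [VectorBundle ℝ F A]
  {E' : Type*} [NormedAddCommGroup E'] [NormedSpace ℝ E']
  {H' : Type*} [TopologicalSpace H'] {I' : ModelWithCorners ℝ E' H'}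
  {O : Type*} [TopologicalSpace O] [ChartedSpace H' O] [IsManifold I' ∞ O]
  {ι : O → M} {σ : ∀ q : O, TangentSpace I' q →L[ℝ] A (ι q)}

/-- The matrix, in the local frames at `q₀` and at `ι q₀`, of a bundle map over `ι`. -/
def liftCoord (σ : ∀ q : O, TangentSpace I' q →L[ℝ] A (ι q)) (q₀ q : O) : E' →L[ℝ] F :=
  coframe F A (ι q₀) (ι q) ∘L σ q ∘L frame E' (TangentSpace I') q₀ q

/-- The pullback of a bilinear form along a linear map. -/
def pullbackBilin {V W : Type*} [TopologicalSpace V] [AddCommGroup V] [Module ℝ V]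
    [TopologicalSpace W] [AddCommGroup W] [Module ℝ W] (B : W →L[ℝ] W →L[ℝ] ℝ) (S : V →L[ℝ] W) :
    V →L[ℝ] V →L[ℝ] ℝ :=
  S.precomp ℝ ∘L B ∘L S

theorem contMDiff_pullbackBilin (hι : ContMDiff I' I ∞ ι)
    {B : ∀ x : M, A x →L[ℝ] A x →L[ℝ] ℝ} (hB : ContMDiff I (I.prod 𝓘(ℝ, F →L[ℝ] F →L[ℝ] ℝ)) ∞
      (fun x => TotalSpace.mk' (F →L[ℝ] F →L[ℝ] ℝ) (E := fun x : M => A x →L[ℝ] A x →L[ℝ] ℝ)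
        x (B x)))
    (hσ : ∀ q₀, ContMDiffAt I' 𝓘(ℝ, E' →L[ℝ] F) ∞ (liftCoord (F := F) σ q₀) q₀) :
    ContMDiff I' (I'.prod 𝓘(ℝ, E' →L[ℝ] E' →L[ℝ] ℝ)) ∞
      (fun q => TotalSpace.mk' (E' →L[ℝ] E' →L[ℝ] ℝ)
        (E := fun q : O => TangentSpace I' q →L[ℝ] TangentSpace I' q →L[ℝ] ℝ)
        q (pullbackBilin (B (ι q)) (σ q))) := by
  refine fun q₀ => contMDiffAt_bilinCoord_iff.1 ?_
  refine (contMDiffAt_bilinearComp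
    ((contMDiffAt_bilinCoord_iff.2 (hB (ι q₀))).comp q₀ (hι q₀))
    (hσ q₀) (hσ q₀)).congr_of_eventuallyEq ?_
  filter_upwards [(hι q₀).continuousAt.eventually
    (eventually_mem_baseSet (F := F) (A := A) (ι q₀))] with q hq
  ext u v
  simp only [bilinCoord_apply, Function.comp_apply, ContinuousLinearMap.bilinearComp_apply,
    liftCoord, ContinuousLinearMap.comp_apply, frame_coframe hq]
  rfl

end Pullback

namespace CompatibleTriple

section Lift

variable {E : Type*} [NormedAddCommGroup E] [NormedSpace ℝ E]
  {H : Type*} [TopologicalSpace H] {I : ModelWithCorners ℝ E H}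
  {M : Type*} [TopologicalSpace M] [ChartedSpace H M] [IsManifold I ∞ M]
  {F : Type*} [NormedAddCommGroup F] [NormedSpace ℝ F]
  {A : M → Type*} [TopologicalSpace (TotalSpace F A)]
  [∀ x, TopologicalSpace (A x)] [∀ x, AddCommGroup (A x)] [∀ x, Module ℝ (A x)]
  [∀ x, IsTopologicalAddGroup (A x)] [∀ x, ContinuousSMul ℝ (A x)]
  [FiberBundle F A] [VectorBundle ℝ F A]
  {𝒜 : LieAlgebroid I F A}
  {E' : Type*} [NormedAddCommGroup E'] [NormedSpace ℝ E']
  {H' : Type*} [TopologicalSpace H'] {I' : ModelWithCorners ℝ E' H'}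
  {O : Type*} [TopologicalSpace O] [ChartedSpace H' O]
  {ι : O → M} {T : CompatibleTriple 𝒜}

/-- `σ` lifts the tangent vectors of `O` through the anchor to `E²`. -/
def IsLift (T : CompatibleTriple 𝒜) (ι : O → M)
    (σ : ∀ q : O, TangentSpace I' q →L[ℝ] A (ι q)) : Prop :=
  ∀ q X, σ q X ∈ T.E2 (ι q) ∧ 𝒜.anchor (ι q) (σ q X) = mfderiv I' I ι q X

theorem exists_isLift [FiniteDimensional ℝ F] [FiniteDimensional ℝ E']
    (hι : IsIntegralImmersion I' T.Λ ι)
    (hJ : ∀ q, ∀ a ∈ T.L2 (ι q), T.J.toFun (ι q) a ∈ T.L2 (ι q)) :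
    ∃ σ : ∀ q : O, TangentSpace I' q →L[ℝ] A (ι q), T.IsLift ι σ := by
  have hlift : ∀ q (X : TangentSpace I' q), ∃ a ∈ T.E2 (ι q),
      𝒜.anchor (ι q) a = mfderiv I' I ι q X :=
    fun q X => T.exists_mem_E2_anchor_eq ((hι.range_mfderiv q).le ⟨X, rfl⟩)
  choose σ hσ hρσ using hlift
  have : ∀ q : O, FiniteDimensional ℝ (TangentSpace I' q) := fun _ =>
    inferInstanceAs (FiniteDimensional ℝ E')
  have : ∀ q : O, T2Space (TangentSpace I' q) := fun _ => inferInstanceAs (T2Space E')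
  let σₗ (q : O) : TangentSpace I' q →ₗ[ℝ] A (ι q) :=
    { toFun := σ q
      map_add' := fun X Y => eq_of_mem_E2_of_anchor_eq (hJ q) (hσ _ _)
        (Submodule.add_mem _ (hσ _ _) (hσ _ _)) (by simp only [map_add, hρσ])
      map_smul' := fun c X => eq_of_mem_E2_of_anchor_eq (hJ q) (hσ _ _)
        (Submodule.smul_mem _ _ (hσ _ _)) (by simp only [map_smul, hρσ, RingHom.id_apply]) }
  exact ⟨fun q => ⟨σₗ q, LinearMap.continuous_of_finiteDimensional _⟩,
    fun q X => ⟨hσ q X, hρσ q X⟩⟩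

theorem IsLift.injective {σ : ∀ q : O, TangentSpace I' q →L[ℝ] A (ι q)} (hσ : T.IsLift ι σ)
    {q : O} (hι : Function.Injective (mfderiv I' I ι q)) : Function.Injective (σ q) :=
  fun X Y h => hι (by rw [← (hσ q X).2, ← (hσ q Y).2, h])

theorem IsLift.exists_apply_eq_J [FiniteDimensional ℝ E] [FiniteDimensional ℝ F]
    {σ : ∀ q : O, TangentSpace I' q →L[ℝ] A (ι q)} (hι : IsIntegralImmersion I' T.Λ ι)
    (hJ : ∀ q, ∀ a ∈ T.L2 (ι q), T.J.toFun (ι q) a ∈ T.L2 (ι q)) (hσ : T.IsLift ι σ) (q : O) :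
    ∃ j : TangentSpace I' q →L[ℝ] TangentSpace I' q,
      ∀ X, σ q (j X) = T.J.toFun (ι q) (σ q X) := by
  obtain ⟨δ, hδ⟩ := hι.hasLeftInverse_mfderiv q
  refine ⟨δ ∘L 𝒜.anchor (ι q) ∘L T.J.toFun (ι q) ∘L σ q, fun X => ?_⟩
  have hJE2 := J_mem_E2 (hJ q) (hσ q X).1
  have hΛ : 𝒜.anchor (ι q) (T.J.toFun (ι q) (σ q X)) ∈ T.Λ (ι q) :=
    T.mem_Λ.2 ⟨_, T.E2_le_orth_L hJE2, rfl⟩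
  rw [← hι.range_mfderiv q] at hΛ
  obtain ⟨Y, hY⟩ := hΛ
  refine eq_of_mem_E2_of_anchor_eq (hJ q) (hσ q _).1 hJE2 ((hσ q _).2.trans ?_)
  exact (congrArg _ ((congrArg δ hY.symm).trans (hδ Y))).trans hY

variable [IsManifold I' ∞ O]

theorem IsLift.homCoord_anchor_liftCoord {σ : ∀ q : O, TangentSpace I' q →L[ℝ] A (ι q)}
    (hσ : T.IsLift ι σ) {q₀ q : O} (hq : ι q ∈ (trivializationAt F A (ι q₀)).baseSet) (v : E') :
    homCoord F E (ι q₀) 𝒜.anchor (ι q) (liftCoord σ q₀ q v) = mfderivCoord I I' ι q₀ q v :=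
  (homCoord_coframe hq _ _).trans (congrArg _ (hσ q _).2)

variable [FiniteDimensional ℝ E] [FiniteDimensional ℝ F] [FiniteDimensional ℝ E'] [T2Space M]
  [I.Boundaryless] [I'.Boundaryless] [ContMDiffVectorBundle ∞ F A I]

theorem IsLift.contMDiffAt_liftCoord {σ : ∀ q : O, TangentSpace I' q →L[ℝ] A (ι q)}
    (hσ : T.IsLift ι σ) (hι : IsIntegralImmersion I' T.Λ ι)
    (hJ : ∀ q, ∀ a ∈ T.L2 (ι q), T.J.toFun (ι q) a ∈ T.L2 (ι q)) (q₀ : O) :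
    ContMDiffAt I' 𝓘(ℝ, E' →L[ℝ] F) ∞ (liftCoord (F := F) σ q₀) q₀ := by
  have hιq₀ := hι.contMDiff q₀
  have hframe (u : F) : coframe F A (ι q₀) (ι q₀) (frame F A (ι q₀) (ι q₀) u) = u :=
    coframe_frame (FiberBundle.mem_baseSet_trivializationAt F A (ι q₀)) u
  obtain ⟨V, hV, hVL, hVmem⟩ := T.exists_anchor_ker_extension hι q₀
  obtain ⟨K, hK, hKlift⟩ := exists_contMDiffAt_orthogonal_lift
    ((𝒜.contMDiffAt_homCoord_anchor (ι q₀)).comp q₀ hιq₀)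
    ((contMDiffAt_bilinCoord_iff.2 (T.g.contMDiff (ι q₀))).comp q₀ hιq₀) hV
    (fun u hu => by
      have hu₀ : frame F A (ι q₀) (ι q₀) u = 0 := T.eq_zero_of_g_self_eq_zero hu
      rw [← hframe u, hu₀, map_zero])
    (fun u hu => by
      have hL : frame F A (ι q₀) (ι q₀) u ∈ T.L (ι q₀) := by
        rw [T.mem_L, ← frame_homCoord (FiberBundle.mem_baseSet_trivializationAt E _ _)]
        exact (congrArg _ hu).trans (map_zero _)
      simpa only [hframe] using hVL _ hL)
  refine (hK.clm_comp (contMDiffAt_mfderivCoord hιq₀)).congr_of_eventuallyEq ?_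
  filter_upwards [hKlift, hVmem, hιq₀.continuousAt.eventually
    (eventually_mem_baseSet (F := F) (A := A) (ι q₀))] with q hKq hVq hq
  ext v
  rw [ContinuousLinearMap.comp_apply, ← hσ.homCoord_anchor_liftCoord hq]
  refine (hKq _ fun w => ?_).symm
  refine Eq.trans ?_ (g_eq_zero_of_mem_E2_of_mem_L (hJ q)
    (hσ q (frame E' (TangentSpace I') q₀ q v)).1 (hVq w))
  exact congrArg (fun a => T.g.inner (ι q) a _) (frame_coframe hq _)

end Lift

end CompatibleTriple

namespace CompatibleTriple

section Induced

variable {E : Type*} [NormedAddCommGroup E] [NormedSpace ℝ E] [FiniteDimensional ℝ E]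
  {H : Type*} [TopologicalSpace H] {I : ModelWithCorners ℝ E H} [I.Boundaryless]
  {M : Type*} [TopologicalSpace M] [T2Space M] [ChartedSpace H M] [IsManifold I ∞ M]
  {F : Type*} [NormedAddCommGroup F] [NormedSpace ℝ F] [FiniteDimensional ℝ F]
  {A : M → Type*} [TopologicalSpace (TotalSpace F A)]
  [∀ x, TopologicalSpace (A x)] [∀ x, AddCommGroup (A x)] [∀ x, Module ℝ (A x)]
  [∀ x, IsTopologicalAddGroup (A x)] [∀ x, ContinuousSMul ℝ (A x)]
  [FiberBundle F A] [VectorBundle ℝ F A] [ContMDiffVectorBundle ∞ F A I]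
  {𝒜 : LieAlgebroid I F A} {T : CompatibleTriple 𝒜}
  {E' : Type*} [NormedAddCommGroup E'] [NormedSpace ℝ E'] [FiniteDimensional ℝ E']
  {H' : Type*} [TopologicalSpace H'] {I' : ModelWithCorners ℝ E' H'} [I'.Boundaryless]
  {O : Type*} [TopologicalSpace O] [ChartedSpace H' O] [IsManifold I' ∞ O]
  {ι : O → M} {σ : ∀ q : O, TangentSpace I' q →L[ℝ] A (ι q)}

/-- The 2-form `ω_O(X, Y) = ω(σ X, σ Y)` induced along an integral immersion, where `σ` is the
lift through the anchor. -/
def inducedForm (hι : IsIntegralImmersion I' T.Λ ι)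
    (hJ : ∀ q, ∀ a ∈ T.L2 (ι q), T.J.toFun (ι q) a ∈ T.L2 (ι q)) (hσ : T.IsLift ι σ) :
    TwoForm I' E' (fun q : O => TangentSpace I' q) where
  toFun q := pullbackBilin (T.form.toFun (ι q)) (σ q)
  alternating _ _ := T.form.alternating _ _
  contMDiff := contMDiff_pullbackBilin hι.contMDiff T.form.contMDiff
    (hσ.contMDiffAt_liftCoord hι hJ)

/-- The Riemannian metric `g_O(X, Y) = g(σ X, σ Y)` induced along an integral immersion, where `σ`
is the lift through the anchor. -/
def inducedMetric (hι : IsIntegralImmersion I' T.Λ ι)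
    (hJ : ∀ q, ∀ a ∈ T.L2 (ι q), T.J.toFun (ι q) a ∈ T.L2 (ι q)) (hσ : T.IsLift ι σ) :
    ContMDiffRiemannianMetric I' ∞ E' (fun q : O => TangentSpace I' q) where
  inner q := pullbackBilin (T.g.inner (ι q)) (σ q)
  symm _ _ _ := T.g.symm _ _ _
  pos q _ hX := T.g.pos _ _ fun h =>
    hX (hσ.injective (hι.injective_mfderiv q) (h.trans (map_zero _).symm))
  isVonNBounded q := by
    obtain ⟨δ, hδ⟩ := hι.hasLeftInverse_mfderiv q
    refine ((T.g.isVonNBounded (ι q)).image (δ ∘L 𝒜.anchor (ι q))).subset fun X hX => ?_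
    exact ⟨σ q X, hX, (congrArg δ (hσ q X).2).trans (hδ X)⟩
  contMDiff := contMDiff_pullbackBilin hι.contMDiff T.g.contMDiff
    (hσ.contMDiffAt_liftCoord hι hJ)

theorem IsLift.exists_almostComplexStructure (hι : IsIntegralImmersion I' T.Λ ι)
    (hJ : ∀ q, ∀ a ∈ T.L2 (ι q), T.J.toFun (ι q) a ∈ T.L2 (ι q)) (hσ : T.IsLift ι σ) :
    ∃ j : AlmostComplexStructure I' E' (fun q : O => TangentSpace I' q),
      ∀ q X, σ q (j.toFun q X) = T.J.toFun (ι q) (σ q X) := by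
  choose j hj using hσ.exists_apply_eq_J hι hJ
  refine ⟨⟨j, fun q₀ => contMDiffAt_homCoord_iff.1 ?_, fun q X => ?_⟩, hj⟩
  · obtain ⟨Ψ, hΨ, hΨcoord⟩ := 𝒜.exists_coframe_eq_of_anchor_eq (hι.contMDiff q₀)
      (hι.injective_mfderiv q₀)
    refine (hΨ.clm_comp (((contMDiffAt_homCoord_iff.2 (T.J.contMDiff (ι q₀))).comp q₀
      (hι.contMDiff q₀)).clm_comp (hσ.contMDiffAt_liftCoord hι hJ q₀))).congr_of_eventuallyEq ?_
    filter_upwards [hΨcoord, (hι.contMDiff q₀).continuousAt.eventually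
      (eventually_mem_baseSet (F := F) (A := A) (ι q₀))] with q hΨq hq
    ext u
    refine (hΨq (j q (frame E' (TangentSpace I') q₀ q u)) _ (hσ q _).2).trans ?_
    rw [hj]
    exact congrArg (Ψ q) (homCoord_coframe hq T.J.toFun _).symm
  · exact hσ.injective (hι.injective_mfderiv q) (by rw [hj, hj, T.J.sq_eq_neg, map_neg])

end Induced

end CompatibleTriple

namespace TwoForm

section Apply

variable {E : Type*} [NormedAddCommGroup E] [NormedSpace ℝ E]
  {H : Type*} [TopologicalSpace H] {I : ModelWithCorners ℝ E H}
  {M : Type*} [TopologicalSpace M] [ChartedSpace H M]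
  {F : Type*} [NormedAddCommGroup F] [NormedSpace ℝ F]
  {A : M → Type*} [TopologicalSpace (TotalSpace F A)]
  [∀ x, TopologicalSpace (A x)] [∀ x, AddCommGroup (A x)] [∀ x, Module ℝ (A x)]
  [FiberBundle F A] [VectorBundle ℝ F A] (η : TwoForm I F A)

theorem mdifferentiableAt_apply {s t : Π x : M, A x} {x : M}
    (hs : MDifferentiableAt I (I.prod 𝓘(ℝ, F)) (fun y => TotalSpace.mk' F y (s y)) x)
    (ht : MDifferentiableAt I (I.prod 𝓘(ℝ, F)) (fun y => TotalSpace.mk' F y (t y)) x) :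
    MDifferentiableAt I 𝓘(ℝ, ℝ) (fun y => η.toFun y (s y) (t y)) x :=
  (mdifferentiableAt_section _ _).1 <|
    MDifferentiableAt.clm_bundle_apply₂ (F₁ := F) (F₂ := F) (F₃ := ℝ) (E₃ := fun _ : M => ℝ)
      ((η.contMDiff x).mdifferentiableAt (by simp)) hs ht

theorem mvfderiv_apply_swap (s t : Π x : M, A x) (x : M) (v : TangentSpace I x) :
    mvfderiv I (fun y => η.toFun y (s y) (t y)) x v =
      -mvfderiv I (fun y => η.toFun y (t y) (s y)) x v := by
  have h : (fun y => η.toFun y (s y) (t y)) = -(fun y => η.toFun y (t y) (s y)) :=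
    funext fun y => η.antisymm _ _
  rw [h, mvfderiv_neg]
  rfl

end Apply

section FieldExtDeriv

open VectorField

variable {E : Type*} [NormedAddCommGroup E] [NormedSpace ℝ E]
  {H : Type*} [TopologicalSpace H] {I : ModelWithCorners ℝ E H}
  {M : Type*} [TopologicalSpace M] [ChartedSpace H M] [IsManifold I ∞ M]
  (η : TwoForm I E (fun x : M => TangentSpace I x))

/-- The exterior derivative of a 2-form on a manifold, evaluated on vector fields. Unlike
`LieAlgebroid.extDeriv` for the tangent algebroid, it accepts fields which are not known to be
smooth, as needed to show that it is tensorial. -/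
def fieldExtDeriv (x : M) (V₀ V₁ V₂ : Π y : M, TangentSpace I y) : ℝ :=
  mvfderiv I (fun y => η.toFun y (V₁ y) (V₂ y)) x (V₀ x)
    - mvfderiv I (fun y => η.toFun y (V₀ y) (V₂ y)) x (V₁ x)
    + mvfderiv I (fun y => η.toFun y (V₀ y) (V₁ y)) x (V₂ x)
    - η.toFun x (mlieBracket I V₀ V₁ x) (V₂ x)
    + η.toFun x (mlieBracket I V₀ V₂ x) (V₁ x)
    - η.toFun x (mlieBracket I V₁ V₂ x) (V₀ x)

theorem fieldExtDeriv_cyclic (x : M) (V₀ V₁ V₂ : Π y : M, TangentSpace I y) :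
    η.fieldExtDeriv x V₀ V₁ V₂ = η.fieldExtDeriv x V₁ V₂ V₀ := by
  simp only [fieldExtDeriv]
  rw [η.mvfderiv_apply_swap V₂ V₀, η.mvfderiv_apply_swap V₁ V₀,
    mlieBracket_swap_apply (V := V₁) (W := V₀), mlieBracket_swap_apply (V := V₂) (W := V₀)]
  simp only [map_neg, neg_apply]
  ring

variable [CompleteSpace E]

theorem tensorialAt_fieldExtDeriv {x : M} {V₁ V₂ : Π y : M, TangentSpace I y}
    (hV₁ : MDiffAt (T% V₁) x) (hV₂ : MDiffAt (T% V₂) x) :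
    TensorialAt I E (fun V₀ => η.fieldExtDeriv x V₀ V₁ V₂) x where
  smul {f V} hf hV := by
    have hsmul (W : Π y : M, TangentSpace I y) : (fun y => η.toFun y ((f • V) y) (W y)) =
        f * (fun y => η.toFun y (V y) (W y)) := by
      ext y
      simp
    simp only [fieldExtDeriv, hsmul]
    rw [mvfderiv_mul hf (η.mdifferentiableAt_apply hV hV₁),
      mvfderiv_mul hf (η.mdifferentiableAt_apply hV hV₂), mlieBracket_smul_left hf hV,
      mlieBracket_smul_left hf hV]
    simp only [Pi.smul_apply', map_smul, map_add, add_apply, smul_apply, smul_eq_mul, neg_smul,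
      map_neg, neg_apply]
    ring
  add {V V'} hV hV' := by
    have hadd (W : Π y : M, TangentSpace I y) : (fun y => η.toFun y ((V + V') y) (W y)) =
        (fun y => η.toFun y (V y) (W y)) + fun y => η.toFun y (V' y) (W y) := by
      ext y
      simp
    simp only [fieldExtDeriv, hadd]
    rw [mvfderiv_add (η.mdifferentiableAt_apply hV hV₁) (η.mdifferentiableAt_apply hV' hV₁),
      mvfderiv_add (η.mdifferentiableAt_apply hV hV₂) (η.mdifferentiableAt_apply hV' hV₂),
      mlieBracket_add_left hV hV', mlieBracket_add_left hV hV']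
    simp only [Pi.add_apply, map_add, add_apply]
    ring

theorem fieldExtDeriv_congr [FiniteDimensional ℝ E] {x : M}
    {V W : Fin 3 → Π y : M, TangentSpace I y}
    (hV : ∀ i, MDiffAt (T% (V i)) x) (hW : ∀ i, MDiffAt (T% (W i)) x) (h : ∀ i, V i x = W i x) :
    η.fieldExtDeriv x (V 0) (V 1) (V 2) = η.fieldExtDeriv x (W 0) (W 1) (W 2) := by
  have : IsManifold I (1 + 1) M := IsManifold.of_le (n := ∞) (WithTop.coe_le_coe.2 le_top)
  rw [(η.tensorialAt_fieldExtDeriv (hV 1) (hV 2)).pointwise (hV 0) (hW 0) (h 0),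
    η.fieldExtDeriv_cyclic,
    (η.tensorialAt_fieldExtDeriv (hV 2) (hW 0)).pointwise (hV 1) (hW 1) (h 1),
    η.fieldExtDeriv_cyclic,
    (η.tensorialAt_fieldExtDeriv (hW 0) (hW 1)).pointwise (hV 2) (hW 2) (h 2),
    η.fieldExtDeriv_cyclic]

end FieldExtDeriv

end TwoForm

section Related

theorem mvfderiv_vector_comp_apply {E : Type*} [NormedAddCommGroup E] [NormedSpace ℝ E]
    {H : Type*} [TopologicalSpace H] {I : ModelWithCorners ℝ E H}
    {M : Type*} [TopologicalSpace M] [ChartedSpace H M]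
    {E' : Type*} [NormedAddCommGroup E'] [NormedSpace ℝ E']
    {H' : Type*} [TopologicalSpace H'] {I' : ModelWithCorners ℝ E' H'}
    {O : Type*} [TopologicalSpace O] [ChartedSpace H' O]
    {G : Type*} [NormedAddCommGroup G] [NormedSpace ℝ G] {f : M → G} {ι : O → M} {q : O}
    (hf : MDifferentiableAt I 𝓘(ℝ, G) f (ι q)) (hι : MDifferentiableAt I' I ι q)
    (v : TangentSpace I' q) :
    mvfderiv I' (f ∘ ι) q v = mvfderiv I f (ι q) (mfderiv I' I ι q v) :=
  mfderiv_comp_apply q hf hι v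

open VectorField

variable {E : Type*} [NormedAddCommGroup E] [NormedSpace ℝ E] [CompleteSpace E]
  {H : Type*} [TopologicalSpace H] {I : ModelWithCorners ℝ E H} [I.Boundaryless]
  {M : Type*} [TopologicalSpace M] [ChartedSpace H M] [IsManifold I ∞ M]
  {E' : Type*} [NormedAddCommGroup E'] [NormedSpace ℝ E'] [CompleteSpace E']
  {H' : Type*} [TopologicalSpace H'] {I' : ModelWithCorners ℝ E' H'} [I'.Boundaryless]
  {O : Type*} [TopologicalSpace O] [ChartedSpace H' O] [IsManifold I' ∞ O]
  {ι : O → M} {q : O}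

theorem mfderiv_mlieBracket_of_related (hι : ContMDiffAt I' I ∞ ι q)
    {V W : Π q : O, TangentSpace I' q} {V' W' : Π x : M, TangentSpace I x}
    (hV : MDiffAt (T% V) q) (hW : MDiffAt (T% W) q)
    (hV' : MDiffAt (T% V') (ι q)) (hW' : MDiffAt (T% W') (ι q))
    (hVV' : ∀ᶠ y in 𝓝 q, mfderiv I' I ι y (V y) = V' (ι y))
    (hWW' : ∀ᶠ y in 𝓝 q, mfderiv I' I ι y (W y) = W' (ι y)) :
    mfderiv I' I ι q (mlieBracket I' V W q) = mlieBracket I V' W' (ι q) := by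
  have : IsManifold I 1 M := IsManifold.of_le (n := ∞) (by norm_cast)
  set φ := extChartAt I (ι q)
  set coord : (Π x : M, TangentSpace I x) → M → E :=
    fun U x => coframe E (TangentSpace I) (ι q) x (U x)
  have hφ : ContMDiffAt I 𝓘(ℝ, E) ∞ φ (ι q) := contMDiffAt_extChartAt
  have hιq : MDifferentiableAt I' I ι q := hι.mdifferentiableAt (by simp)
  have hcoordV : MDifferentiableAt I 𝓘(ℝ, E) (coord V') (ι q) :=
    mdifferentiableAt_section_iff_coframe.1 hV'
  have hcoordW : MDifferentiableAt I 𝓘(ℝ, E) (coord W') (ι q) :=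
    mdifferentiableAt_section_iff_coframe.1 hW'
  have hcoord (U : Π x : M, TangentSpace I x) :
      ∀ᶠ x in 𝓝 (ι q), mvfderiv I φ x (U x) = coord U x := by
    filter_upwards [chart_source_mem_nhds H (ι q)] with x hx
    exact DFunLike.congr_fun (coframe_tangent hx).symm (U x)
  have hcoord_comp {U : Π y : O, TangentSpace I' y} {U' : Π x : M, TangentSpace I x}
      (hU : ∀ᶠ y in 𝓝 q, mfderiv I' I ι y (U y) = U' (ι y)) :
      ∀ᶠ y in 𝓝 q, mvfderiv I' (φ ∘ ι) y (U y) = (coord U' ∘ ι) y := by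
    filter_upwards [hU, hι.continuousAt.eventually (hcoord U'),
      hι.continuousAt.eventually (eventually_mdifferentiableAt_of_contMDiffAt hφ),
      eventually_mdifferentiableAt_of_contMDiffAt hι] with y hy hy' hφy hιy
    rw [mvfderiv_vector_comp_apply hφy hιy, hy]
    exact hy'
  have hbracket := mvfderiv_mlieBracket (hφ.comp q hι) hV hW (hcoordV.comp q hιq)
    (hcoordW.comp q hιq) (hcoord_comp hVV') (hcoord_comp hWW')
  rw [mvfderiv_vector_comp_apply (hφ.mdifferentiableAt (by simp)) hιq,
    mvfderiv_vector_comp_apply hcoordV hιq, mvfderiv_vector_comp_apply hcoordW hιq,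
    hVV'.self_of_nhds, hWW'.self_of_nhds,
    ← mvfderiv_mlieBracket hφ hV' hW' hcoordV hcoordW (hcoord V') (hcoord W'),
    ← coframe_tangent (mem_chart_source H (ι q))] at hbracket
  exact coframe_injective (FiberBundle.mem_baseSet_trivializationAt' (ι q)) hbracket

end Related

namespace CompatibleTriple

section Uniqueness

variable {E : Type*} [NormedAddCommGroup E] [NormedSpace ℝ E]
  {H : Type*} [TopologicalSpace H] {I : ModelWithCorners ℝ E H}
  {M : Type*} [TopologicalSpace M] [ChartedSpace H M] [IsManifold I ∞ M]
  {F : Type*} [NormedAddCommGroup F] [NormedSpace ℝ F]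
  {A : M → Type*} [TopologicalSpace (TotalSpace F A)]
  [∀ x, TopologicalSpace (A x)] [∀ x, AddCommGroup (A x)] [∀ x, Module ℝ (A x)]
  [∀ x, IsTopologicalAddGroup (A x)] [∀ x, ContinuousSMul ℝ (A x)]
  [FiberBundle F A] [VectorBundle ℝ F A]
  {𝒜 : LieAlgebroid I F A}

theorem ext_form_J_g {S S' : CompatibleTriple 𝒜}
    (hform : ∀ x v w, S.form.toFun x v w = S'.form.toFun x v w)
    (hJ : ∀ x v, S.J.toFun x v = S'.J.toFun x v)
    (hg : ∀ x v w, S.g.inner x v w = S'.g.inner x v w) : S = S' := by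
  obtain ⟨⟨form, _, _⟩, ⟨J, _, _⟩, ⟨g, _, _, _, _⟩, _, _, _⟩ := S
  obtain ⟨⟨form', _, _⟩, ⟨J', _, _⟩, ⟨g', _, _, _, _⟩, _, _, _⟩ := S'
  obtain rfl : form = form' := by
    ext x v w
    exact hform x v w
  obtain rfl : J = J' := by
    ext x v
    exact hJ x v
  obtain rfl : g = g' := by
    ext x v w
    exact hg x v w
  rfl

variable {T : CompatibleTriple 𝒜} [FiniteDimensional ℝ F]
  {E' : Type*} [NormedAddCommGroup E'] [NormedSpace ℝ E']
  {H' : Type*} [TopologicalSpace H'] {I' : ModelWithCorners ℝ E' H'}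
  {O : Type*} [TopologicalSpace O] [ChartedSpace H' O] [IsManifold I' ∞ O] {ι : O → M}

theorem eq_of_isInducedTriple (hι : IsIntegralImmersion I' T.Λ ι)
    {ℬ : LieAlgebroid I' E' (fun q : O => TangentSpace I' q)} {S S' : CompatibleTriple ℬ}
    (hS : IsInducedTriple I' T ι S) (hS' : IsInducedTriple I' T ι S') : S = S' := by
  have hlift (q : O) (X : TangentSpace I' q) : ∃ a ∈ T.E2 (ι q),
      𝒜.anchor (ι q) a = mfderiv I' I ι q X :=
    T.exists_mem_E2_anchor_eq (by rw [← hι.range_mfderiv q]; exact ⟨X, rfl⟩)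
  refine ext_form_J_g (fun q X Y => ?_) (fun q X => ?_) (fun q X Y => ?_) <;>
    obtain ⟨a, ha, haX⟩ := hlift q X
  · obtain ⟨b, hb, hbY⟩ := hlift q Y
    have ha' := Submodule.mem_sup_left (T := T.L1 (ι q)) ha
    have hb' := Submodule.mem_sup_left (T := T.L1 (ι q)) hb
    rw [hS.form_eq q X Y a b ha' hb' haX hbY, hS'.form_eq q X Y a b ha' hb' haX hbY]
  · apply hι.injective_mfderiv q
    rw [hS.J_eq q X a ha haX, hS'.J_eq q X a ha haX]
  · obtain ⟨b, hb, hbY⟩ := hlift q Y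
    rw [hS.g_eq q X Y a b ha hb haX hbY, hS'.g_eq q X Y a b ha hb haX hbY]

end Uniqueness

section Existence

open VectorField

variable {E : Type*} [NormedAddCommGroup E] [NormedSpace ℝ E] [FiniteDimensional ℝ E]
  {H : Type*} [TopologicalSpace H] {I : ModelWithCorners ℝ E H} [I.Boundaryless]
  {M : Type*} [TopologicalSpace M] [T2Space M] [ChartedSpace H M] [IsManifold I ∞ M]
  {F : Type*} [NormedAddCommGroup F] [NormedSpace ℝ F] [FiniteDimensional ℝ F]
  {A : M → Type*} [TopologicalSpace (TotalSpace F A)]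
  [∀ x, TopologicalSpace (A x)] [∀ x, AddCommGroup (A x)] [∀ x, Module ℝ (A x)]
  [∀ x, IsTopologicalAddGroup (A x)] [∀ x, ContinuousSMul ℝ (A x)]
  [FiberBundle F A] [VectorBundle ℝ F A] [ContMDiffVectorBundle ∞ F A I]
  {𝒜 : LieAlgebroid I F A} {T : CompatibleTriple 𝒜}
  {E' : Type*} [NormedAddCommGroup E'] [NormedSpace ℝ E'] [FiniteDimensional ℝ E']
  {H' : Type*} [TopologicalSpace H'] {I' : ModelWithCorners ℝ E' H'} [I'.Boundaryless]
  {O : Type*} [TopologicalSpace O] [ChartedSpace H' O] [IsManifold I' ∞ O]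
  {ι : O → M} {σ : ∀ q : O, TangentSpace I' q →L[ℝ] A (ι q)}

theorem fieldExtDeriv_inducedForm_of_related (hι : IsIntegralImmersion I' T.Λ ι)
    (hJ : ∀ q, ∀ a ∈ T.L2 (ι q), T.J.toFun (ι q) a ∈ T.L2 (ι q)) (hσ : T.IsLift ι σ)
    {s : Fin 3 → Cₛ^∞⟮I; F, A⟯} (hs : ∀ i x, s i x ∈ orth (T.form.toFun x) (T.L x))
    {Y : Fin 3 → Cₛ^∞⟮I'; E', fun q : O => TangentSpace I' q⟯}
    (hY : ∀ i q, mfderiv I' I ι q (Y i q) = 𝒜.anchor (ι q) (s i (ι q))) (q : O) :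
    (inducedForm hι hJ hσ).fieldExtDeriv q (Y 0) (Y 1) (Y 2) = 0 := by
  have := FiniteDimensional.complete ℝ E
  have := FiniteDimensional.complete ℝ E'
  have hform {q : O} {X : TangentSpace I' q} {a : A (ι q)}
      (hX : mfderiv I' I ι q X = 𝒜.anchor (ι q) a) (k : Fin 3) :
      (inducedForm hι hJ hσ).toFun q X (Y k q) = T.form.toFun (ι q) a (s k (ι q)) :=
    T.form_congr_of_anchor_eq (T.E2_le_orth_L (hσ q X).1) (hs k (ι q)) ((hσ q X).2.trans hX)
      ((hσ q _).2.trans (hY k q))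
  have hderiv (i j k : Fin 3) :
      mvfderiv I' (fun y => (inducedForm hι hJ hσ).toFun y (Y i y) (Y j y)) q (Y k q) =
        mvfderiv I (fun x => T.form.toFun x (s i x) (s j x)) (ι q)
          (𝒜.anchor (ι q) (s k (ι q))) := by
    have hcomp : (fun y => (inducedForm hι hJ hσ).toFun y (Y i y) (Y j y)) =
        (fun x => T.form.toFun x (s i x) (s j x)) ∘ ι := funext fun y => hform (hY i y) j
    rw [hcomp, ← hY]
    exact mvfderiv_comp_apply q
      (T.form.mdifferentiableAt_apply (s i).mdifferentiableAt (s j).mdifferentiableAt)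
      (hι.contMDiff.mdifferentiable (by simp) q) (Y k q)
  have hbracket (i j k : Fin 3) :
      (inducedForm hι hJ hσ).toFun q (mlieBracket I' (Y i) (Y j) q) (Y k q) =
        T.form.toFun (ι q) (𝒜.bracket (s i) (s j) (ι q)) (s k (ι q)) := by
    refine hform ?_ k
    rw [𝒜.anchor_bracket]
    exact mfderiv_mlieBracket_of_related (hι.contMDiff q) (Y i).mdifferentiableAt
      (Y j).mdifferentiableAt (𝒜.mdifferentiableAt_anchor_section (s i) (ι q))
      (𝒜.mdifferentiableAt_anchor_section (s j) (ι q)) (Eventually.of_forall (hY i))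
      (Eventually.of_forall (hY j))
  simp only [TwoForm.fieldExtDeriv, hderiv, hbracket]
  exact T.isSymplectic.closed (s 0) (s 1) (s 2) (ι q)

theorem extDeriv_inducedForm (hι : IsIntegralImmersion I' T.Λ ι)
    (hJ : ∀ q, ∀ a ∈ T.L2 (ι q), T.J.toFun (ι q) a ∈ T.L2 (ι q)) (hσ : T.IsLift ι σ)
    (V₀ V₁ V₂ : Cₛ^∞⟮I'; E', fun q : O => TangentSpace I' q⟯) (q : O) :
    (tangentLieAlgebroid I' O).extDeriv (inducedForm hι hJ hσ) V₀ V₁ V₂ q = 0 := by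
  have := FiniteDimensional.complete ℝ E'
  choose s Y hs hY hYq using fun i : Fin 3 => T.exists_related_section hι (![V₀, V₁, V₂] i q)
  refine (TwoForm.fieldExtDeriv_congr _ (V := fun i => ![V₀, V₁, V₂] i) (W := fun i => Y i)
    (fun i => ContMDiffSection.mdifferentiableAt _) (fun i => (Y i).mdifferentiableAt)
    fun i => (hYq i).symm).trans ?_
  exact fieldExtDeriv_inducedForm_of_related hι hJ hσ hs hY q

theorem exists_isInducedTriple (hι : IsIntegralImmersion I' T.Λ ι)
    (hJ : ∀ q, ∀ a ∈ T.L2 (ι q), T.J.toFun (ι q) a ∈ T.L2 (ι q)) :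
    ∃ S : CompatibleTriple (tangentLieAlgebroid I' O), IsInducedTriple I' T ι S := by
  obtain ⟨σ, hσ⟩ := T.exists_isLift hι hJ
  obtain ⟨j, hj⟩ := hσ.exists_almostComplexStructure hι hJ
  have hinj (q : O) : Function.Injective (σ q) := hσ.injective (hι.injective_mfderiv q)
  have hlift {q : O} {X : TangentSpace I' q} {a : A (ι q)} (ha : a ∈ T.E2 (ι q))
      (haX : 𝒜.anchor (ι q) a = mfderiv I' I ι q X) : a = σ q X :=
    eq_of_mem_E2_of_anchor_eq (hJ q) ha (hσ q X).1 (haX.trans (hσ q X).2.symm)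
  refine ⟨{ form := inducedForm hι hJ hσ
            J := j
            g := inducedMetric hι hJ hσ
            isSymplectic := ⟨extDeriv_inducedForm hι hJ hσ, fun q X hX => ?_⟩
            g_J_J := fun q X Y => ?_
            form_eq := fun q X Y => ?_ }, ⟨?_, ?_, ?_⟩⟩
  · have hg : T.g.inner (ι q) (σ q X) (σ q X) = 0 := by
      rw [← neg_eq_zero, ← T.form_J_right, ← hj]
      exact hX (j.toFun q X)
    exact hinj q ((T.eq_zero_of_g_self_eq_zero hg).trans (map_zero _).symm)
  · change T.g.inner (ι q) (σ q _) (σ q _) = T.g.inner (ι q) (σ q _) (σ q _)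
    rw [hj, hj, T.g_J_J]
  · change T.form.toFun (ι q) (σ q _) (σ q _) = T.g.inner (ι q) (σ q _) (σ q _)
    rw [hj, T.form_eq]
  · intro q X Y a b _ hb haX hbY
    rw [T.E2_sup_L1] at hb
    exact T.form_congr_of_anchor_eq (T.E2_le_orth_L (hσ q X).1) hb ((hσ q X).2.trans haX.symm)
      ((hσ q Y).2.trans hbY.symm)
  · intro q X a ha haX
    rw [hlift ha haX, ← hj, (hσ q _).2]
  · intro q X Y a b ha hb haX hbY
    rw [hlift ha haX, hlift hb hbY]
    rfl

end Existence

end CompatibleTriple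

end CompatTriples

end

theorem mainTheorem7_general
    {E : Type*} [NormedAddCommGroup E] [NormedSpace ℝ E] [FiniteDimensional ℝ E]
    {H : Type*} [TopologicalSpace H] (I : ModelWithCorners ℝ E H) [I.Boundaryless]
    {M : Type*} [TopologicalSpace M] [T2Space M] [ChartedSpace H M] [IsManifold I ∞ M]
    {F : Type*} [NormedAddCommGroup F] [NormedSpace ℝ F] [FiniteDimensional ℝ F]
    {A : M → Type*} [TopologicalSpace (TotalSpace F A)]
    [∀ p, TopologicalSpace (A p)] [∀ p, AddCommGroup (A p)] [∀ p, Module ℝ (A p)]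
    [∀ p, IsTopologicalAddGroup (A p)] [∀ p, ContinuousSMul ℝ (A p)]
    [FiberBundle F A] [VectorBundle ℝ F A] [ContMDiffVectorBundle ∞ F A I]
    (𝒜 : CompatTriples.LieAlgebroid I F A) (T : CompatTriples.CompatibleTriple 𝒜) :
    (∀ p, (∀ a ∈ T.L2 p, T.J.toFun p a ∈ T.L2 p) → ∀ a ∈ T.E2 p, T.J.toFun p a ∈ T.E2 p) ∧
    ∀ {E' : Type*} [NormedAddCommGroup E'] [NormedSpace ℝ E'] [FiniteDimensional ℝ E']
      {H' : Type*} [TopologicalSpace H'] (I' : ModelWithCorners ℝ E' H') [I'.Boundaryless]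
      {O : Type*} [TopologicalSpace O] [ChartedSpace H' O] [IsManifold I' ∞ O]
      (ι : O → M), CompatTriples.IsIntegralImmersion I' T.Λ ι →
      (∀ q, ∀ a ∈ T.L2 (ι q), T.J.toFun (ι q) a ∈ T.L2 (ι q)) →
      ∃! S : CompatTriples.CompatibleTriple (CompatTriples.tangentLieAlgebroid I' O),
        CompatTriples.IsInducedTriple I' T ι S := by
  refine ⟨fun p hJ _ ha => CompatTriples.CompatibleTriple.J_mem_E2 hJ ha, ?_⟩
  intro E' _ _ _ H' _ I' _ O _ _ _ ι hι hJ
  obtain ⟨S, hS⟩ := CompatTriples.CompatibleTriple.exists_isInducedTriple hι hJ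
  exact ⟨S, hS, fun _ hS' => CompatTriples.CompatibleTriple.eq_of_isInducedTriple hι hS' hS⟩

theorem mainTheorem7
    {E : Type*} [NormedAddCommGroup E] [NormedSpace ℝ E] [FiniteDimensional ℝ E]
    {H : Type*} [TopologicalSpace H] (I : ModelWithCorners ℝ E H) [I.Boundaryless]
    {M : Type*} [TopologicalSpace M] [T2Space M] [ChartedSpace H M] [IsManifold I ∞ M]
    {F : Type*} [NormedAddCommGroup F] [NormedSpace ℝ F] [FiniteDimensional ℝ F]
    {A : M → Type*} [TopologicalSpace (TotalSpace F A)]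
    [∀ p, TopologicalSpace (A p)] [∀ p, AddCommGroup (A p)] [∀ p, Module ℝ (A p)]
    [∀ p, IsTopologicalAddGroup (A p)] [∀ p, ContinuousSMul ℝ (A p)]
    [FiberBundle F A] [VectorBundle ℝ F A] [ContMDiffVectorBundle ∞ F A I]
    (𝒜 : CompatTriples.LieAlgebroid I F A) (T : CompatTriples.CompatibleTriple 𝒜)
    (hJ : ∀ p, ∀ a ∈ T.L2 p, T.J.toFun p a ∈ T.L2 p) :
    (∀ p, ∀ a ∈ T.E2 p, T.J.toFun p a ∈ T.E2 p) ∧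
    ∀ {E' : Type*} [NormedAddCommGroup E'] [NormedSpace ℝ E'] [FiniteDimensional ℝ E']
      {H' : Type*} [TopologicalSpace H'] (I' : ModelWithCorners ℝ E' H') [I'.Boundaryless]
      {O : Type*} [TopologicalSpace O] [ChartedSpace H' O] [IsManifold I' ∞ O]
      (ι : O → M), CompatTriples.IsIntegralSubmanifold I' T.Λ ι →
      ∃! S : CompatTriples.CompatibleTriple (CompatTriples.tangentLieAlgebroid I' O),
        CompatTriples.IsInducedTriple I' T ι S :=
  have h := mainTheorem7_general I 𝒜 T
  ⟨fun p => h.1 p (hJ p),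
    fun I' _ _ _ _ _ ι hι => h.2 I' ι hι.isIntegralImmersion fun q => hJ (ι q)⟩
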